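/- Let $V$ be a three-dimensional complex vector space with basis $x_0,x_1,x_2$, let $\mathbb P(V)=\operatorname{Proj}(\operatorname{Sym}V)$ be the projective plane of rank-one quotients of $V$, and let $n\ge 0$. Let $H=\operatorname{Hilb}^{n+1}_{\mathbb P(V)}$ be the Hilbert scheme of length-$(n+1)$ subschemes, with universal subscheme $\mathcal Z\subseteq \mathbb P(V)\times H$, and put $$\mathcal E_k=p_{1*}(\mathcal O_{\mathcal Z}\otimes p_2^*\mathcal O_{\mathbb P(V)}(k)),\qquad \mathcal L=\textstyle\bigwedge^{n+1}\mathcal E_0\otimes\bigwedge^{n+1}\mathcal E_{-1}^{\vee},$$ where $p_1,p_2$ are the projections to $H$ and to $\mathbb P(V)$. For $\ell\in V$ let $m_\ell:\mathcal E_{-1}\to\mathcal E_0$ be multiplication by $\ell$. The maps $$v_1\wedge\dots\wedge v_n\longmapsto 1\wedge m_\ell v_1\wedge\dots\wedge m_\ell v_n$$ (the maximal minors of $\mathcal E_{-1}\to\mathcal E_0/\mathcal O_H$) are sections of $\mathcal Hom(\bigwedge^n\mathcal E_{-1},\bigwedge^{n+1}\mathcal E_0)\cong\mathcal E_{-1}\otimes\mathcal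 L$, the isomorphism being $e\otimes(d\otimes\theta)\mapsto(\omega\mapsto\theta(e\wedge\omega)\,d)$. 1. There is a unique bundle map $p:S_nV\otimes\mathcal O_H\to\mathcal E_{-1}\otimes\mathcal L$ that sends $\ell^n$ to the section above for every $\ell\in V$, and $p$ is surjective. 2. The same holds over every $\mathbb C$-scheme $T$ for every closed subscheme $Z\subseteq\mathbb P(V)\times T$ that is finite and locally free of rank $n+1$ over $T$. Moreover, for every affine open $U\subseteq T$ and every rank-one (invertible) quotient $q:(\mathcal E_{-1}\otimes\mathcal L)|_U\to M$, the composite $q\circ p:S_nV\otimes\mathcal O_U\to M$ is again a rank-one quotient. Thus the rational map $\mathbb P(\mathcal E_{-1}\otimes\mathcal L)\dashrightarrow\mathbb P(S_nV)$ induced by $p$ (the one used to parametrize the Darboux locus) is defined at every point, i.e. it is a morphism. 3. If $I\subseteq\mathbb C[x,y]$ is an ideal with $\sqrt I=(x,y)$, then all $1-ax-by$ with $a,b\in\mathbb C$ are invertible in $\mathbb C[x,y]/I$, and their inverses span $\mathbb C[x,y]/I$ as a complex vector space. -/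

import Mathlib

open AlgebraicGeometry CategoryTheory CategoryTheory.Limits
open scoped TensorProduct

noncomputable section

namespace DarbouxBundle

/-! ### The projective plane -/

/-- The graded pieces `S_d V` of `S = Sym V = ℂ[x₀, x₁, x₂]`, where `V` is the vector space with
basis `x₀, x₁, x₂`. -/
abbrev Sym (d : ℕ) : Submodule ℂ (MvPolynomial (Fin 3) ℂ) :=
  MvPolynomial.homogeneousSubmodule (Fin 3) ℂ d

instance gradedSym : GradedAlgebra Sym := MvPolynomial.gradedAlgebra

/-- The plane `ℙ(V) = Proj (Sym V)` of rank one quotients of `V`. -/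
abbrev Plane : Scheme.{0} := Proj Sym

/-- The structure morphism `ℙ(V) ⟶ Spec ℂ`. -/
def planeStr : Plane ⟶ Spec (.of ℂ) :=
  Proj.toSpecZero Sym ≫ Spec.map (CommRingCat.ofHom (algebraMap ℂ (Sym 0)))

/-- The coordinate `xᵢ` as an element of `V = S_1 V`. -/
def coord (i : Fin 3) : Sym 1 := ⟨MvPolynomial.X i, MvPolynomial.isHomogeneous_X ℂ i⟩

/-- The standard affine open `xᵢ ≠ 0`. -/
abbrev planeChart (i : Fin 3) : Plane.Opens := Proj.basicOpen Sym (coord i : MvPolynomial (Fin 3) ℂ)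

/-- The regular function `ℓ / xᵢ` on the open set `xᵢ ≠ 0`, for a linear form `ℓ ∈ V`. -/
def ratio (i : Fin 3) (ℓ : Sym 1) : Γ(Plane, planeChart i) :=
  Proj.awayToSection Sym (coord i : MvPolynomial (Fin 3) ℂ)
    (HomogeneousLocalization.mk ⟨1, ℓ, coord i, ⟨1, pow_one _⟩⟩)

/-- `ℓ ^ n` as an element of `S_n V`, for `ℓ ∈ V`. -/
def powForm (n : ℕ) (ℓ : Sym 1) : Sym n :=
  ⟨(ℓ : MvPolynomial (Fin 3) ℂ) ^ n, by simpa using (show MvPolynomial.IsHomogeneous _ 1 from ℓ.2).pow n⟩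

lemma ratio_mul_ratio {i j : Fin 3} {W : Plane.Opens} (hi : W ≤ planeChart i)
    (hj : W ≤ planeChart j) (ℓ : Sym 1) :
    Plane.presheaf.map (homOfLE hj).op (ratio j ℓ) *
      Plane.presheaf.map (homOfLE hi).op (ratio i (coord j)) =
      Plane.presheaf.map (homOfLE hi).op (ratio i ℓ) := by
  apply Subtype.ext
  ext x
  have : x.1.asHomogeneousIdeal.toIdeal.IsPrime := x.1.isPrime
  change (HomogeneousLocalization.mk _ * HomogeneousLocalization.mk _ :
      HomogeneousLocalization.AtPrime Sym x.1.asHomogeneousIdeal.toIdeal).val =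
    (HomogeneousLocalization.mk _ : HomogeneousLocalization.AtPrime Sym x.1.asHomogeneousIdeal.toIdeal).val
  rw [HomogeneousLocalization.val_mul, HomogeneousLocalization.val_mk,
    HomogeneousLocalization.val_mk, HomogeneousLocalization.val_mk, Localization.mk_mul,
    Localization.mk_eq_mk_iff, Localization.r_iff_exists]
  refine ⟨1, ?_⟩
  simp
  ring

/-! ### Flat families of subschemes of the plane and the Hilbert scheme -/

/-- A flat family of length-`r` subschemes of `ℙ(V)` over a `ℂ`-scheme `T`: a closed subscheme
`Z ⊆ ℙ(V) × T` which is finite and locally free of rank `r` over `T`. -/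
structure Family (r : ℕ) {T : Scheme.{0}} (t : T ⟶ Spec (.of ℂ)) where
  Z : Scheme.{0}
  /-- the projection to the base -/
  toBase : Z ⟶ T
  /-- the projection to the plane -/
  toPlane : Z ⟶ Plane
  comm : toPlane ≫ planeStr = toBase ≫ t
  isClosedImmersion : IsClosedImmersion (pullback.lift toPlane toBase comm)
  isFinite : IsFinite toBase
  flat : Flat toBase
  locallyOfFinitePresentation : LocallyOfFinitePresentation toBase
  finrank_eq : ∀ x : T, toBase.finrank x = r

/-- `Hilb^r_{ℙ(V)}`: the `ℂ`-scheme `H` with its family `F` is the Hilbert scheme with its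
universal family, that is, every family `G` over a `ℂ`-scheme `T` is the pullback of `F` (as a
subscheme of `ℙ(V) × T`) under exactly one `ℂ`-morphism `T ⟶ H`. -/
def Family.IsUniversal {r : ℕ} {H : Scheme.{0}} {h : H ⟶ Spec (.of ℂ)} (F : Family r h) : Prop :=
  ∀ (T : Scheme.{0}) (t : T ⟶ Spec (.of ℂ)) (G : Family r t),
    ∃! f : T ⟶ H, f ≫ h = t ∧
      ∃ g : G.Z ⟶ F.Z, IsPullback g G.toBase F.toBase f ∧ g ≫ F.toPlane = G.toPlane

namespace Family

variable {r : ℕ} {T : Scheme.{0}} {t : T ⟶ Spec (.of ℂ)} (F : Family r t) (U : T.Opens)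

/-- The ring `Γ(U, 𝒪_T)`, for an open `U` of the base. -/
def Base (_F : Family r t) (U : T.Opens) : Type := Γ(T, U)

instance : CommRing (F.Base U) := inferInstanceAs (CommRing Γ(T, U))

instance : Algebra ℂ (F.Base U) :=
  ((Scheme.ΓSpecIso (.of ℂ)).inv ≫ t.appLE ⊤ U le_top).hom.toAlgebra

/-- The part of `Z` above `U` where `xᵢ ≠ 0`. -/
def chart (i : Fin 3) : F.Z.Opens := F.toBase ⁻¹ᵁ U ⊓ F.toPlane ⁻¹ᵁ planeChart i

/-- The ring of functions on the part of `Z` above `U` where `xᵢ ≠ 0`. -/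
def ChartRing (i : Fin 3) : Type := Γ(F.Z, F.chart U i)

instance (i : Fin 3) : CommRing (F.ChartRing U i) := inferInstanceAs (CommRing Γ(F.Z, F.chart U i))

instance (i : Fin 3) : Algebra (F.Base U) (F.ChartRing U i) :=
  (F.toBase.appLE U (F.chart U i) inf_le_left).hom.toAlgebra

/-- Restriction of functions to the part of `Z` above `U` where `xᵢ ≠ 0` and `xⱼ ≠ 0`. -/
def resLeft (i j : Fin 3) : F.ChartRing U i →+* Γ(F.Z, F.chart U i ⊓ F.chart U j) :=
  (F.Z.presheaf.map (homOfLE inf_le_left).op).hom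

/-- Restriction of functions to the part of `Z` above `U` where `xᵢ ≠ 0` and `xⱼ ≠ 0`. -/
def resRight (i j : Fin 3) : F.ChartRing U j →+* Γ(F.Z, F.chart U i ⊓ F.chart U j) :=
  (F.Z.presheaf.map (homOfLE inf_le_right).op).hom

/-- The function `ℓ / xᵢ` on the part of `Z` above `U` where `xᵢ ≠ 0`. -/
def frac (i : Fin 3) (ℓ : Sym 1) : F.ChartRing U i :=
  F.toPlane.appLE (planeChart i) (F.chart U i) inf_le_right (ratio i ℓ)

lemma resLeft_algebraMap (i j : Fin 3) (a : F.Base U) :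
    F.resLeft U i j (algebraMap (F.Base U) _ a) =
      F.toBase.appLE U (F.chart U i ⊓ F.chart U j) (inf_le_left.trans inf_le_left) a :=
  congr($(F.toBase.appLE_map (U := U) (V := F.chart U i) inf_le_left
    (homOfLE (inf_le_left : F.chart U i ⊓ F.chart U j ≤ _)).op) a)

lemma resRight_algebraMap (i j : Fin 3) (a : F.Base U) :
    F.resRight U i j (algebraMap (F.Base U) _ a) =
      F.toBase.appLE U (F.chart U i ⊓ F.chart U j) (inf_le_left.trans inf_le_left) a :=
  congr($(F.toBase.appLE_map (U := U) (V := F.chart U j) inf_le_left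
    (homOfLE (inf_le_right : F.chart U i ⊓ F.chart U j ≤ _)).op) a)

lemma resLeft_frac (i j : Fin 3) (ℓ : Sym 1) :
    F.resLeft U i j (F.frac U i ℓ) =
      F.toPlane.appLE (planeChart i ⊓ planeChart j) (F.chart U i ⊓ F.chart U j)
        (inf_le_inf inf_le_right inf_le_right)
        (Plane.presheaf.map (homOfLE inf_le_left).op (ratio i ℓ)) :=
  congr($((F.toPlane.appLE_map (U := planeChart i) (V := F.chart U i) inf_le_right
    (homOfLE (inf_le_left : F.chart U i ⊓ F.chart U j ≤ _)).op).trans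
    (F.toPlane.map_appLE (U := planeChart i ⊓ planeChart j) (V := F.chart U i ⊓ F.chart U j)
      (inf_le_inf inf_le_right inf_le_right) (homOfLE inf_le_left).op).symm) (ratio i ℓ))

lemma resRight_frac (i j : Fin 3) (ℓ : Sym 1) :
    F.resRight U i j (F.frac U j ℓ) =
      F.toPlane.appLE (planeChart i ⊓ planeChart j) (F.chart U i ⊓ F.chart U j)
        (inf_le_inf inf_le_right inf_le_right)
        (Plane.presheaf.map (homOfLE inf_le_right).op (ratio j ℓ)) :=
  congr($((F.toPlane.appLE_map (U := planeChart j) (V := F.chart U j) inf_le_right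
    (homOfLE (inf_le_right : F.chart U i ⊓ F.chart U j ≤ _)).op).trans
    (F.toPlane.map_appLE (U := planeChart i ⊓ planeChart j) (V := F.chart U i ⊓ F.chart U j)
      (inf_le_inf inf_le_right inf_le_right) (homOfLE inf_le_right).op).symm) (ratio j ℓ))

lemma frac_mul_frac (i j : Fin 3) (ℓ : Sym 1) :
    F.resRight U i j (F.frac U j ℓ) * F.resLeft U i j (F.frac U i (coord j)) =
      F.resLeft U i j (F.frac U i ℓ) := by
  rw [resRight_frac, resLeft_frac, resLeft_frac, ← map_mul]
  congr 1
  exact ratio_mul_ratio _ _ ℓ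

/-- The sections over `U` of the bundle `ℰ_k = p₁_* (𝒪_Z ⊗ p₂^* 𝒪(k))`. A section is written as
`fᵢ xᵢ ^ k` where `xᵢ ≠ 0`, so that `fⱼ = (xᵢ / xⱼ) ^ k fᵢ` where `xᵢ ≠ 0` and `xⱼ ≠ 0`; one of the
two exponents `k.toNat`, `(-k).toNat` is zero. -/
def E (k : ℤ) : Submodule (F.Base U) ((i : Fin 3) → F.ChartRing U i) where
  carrier := {f | ∀ i j, F.resRight U i j (f j) =
    F.resRight U i j (F.frac U j (coord i)) ^ k.toNat *
      F.resLeft U i j (F.frac U i (coord j)) ^ (-k).toNat * F.resLeft U i j (f i)}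
  add_mem' {f g} hf hg i j := by
    simp only [Pi.add_apply, map_add, mul_add, hf i j, hg i j]
  zero_mem' i j := by simp
  smul_mem' a f hf i j := by
    simp only [Pi.smul_apply, Algebra.smul_def, map_mul, hf i j, resLeft_algebraMap,
      resRight_algebraMap]
    ring

/-- The section `1` of `ℰ_0`. -/
def one : F.E U 0 := ⟨fun _ => 1, fun i j => by simp⟩

/-- Multiplication `m_ℓ : ℰ_{-1} → ℰ_0` by a linear form `ℓ ∈ V`. -/
def mulForm (ℓ : Sym 1) : F.E U (-1) →ₗ[F.Base U] F.E U 0 where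
  toFun s := ⟨fun i => F.frac U i ℓ * s.1 i, fun i j => by
    have h := s.2 i j
    simp only [Int.reduceNeg, neg_neg, Int.toNat_one, pow_one, Int.reduceToNat, pow_zero,
      one_mul] at h
    simp only [Int.toNat_zero, neg_zero, pow_zero, one_mul, map_mul]
    rw [h, ← mul_assoc, frac_mul_frac]⟩
  map_add' s s' := by ext i; simp [mul_add]
  map_smul' a s := by ext i; simp

end Family

/-! ### The bundle map -/

namespace Family

variable {n : ℕ} {T : Scheme.{0}} {t : T ⟶ Spec (.of ℂ)} (F : Family (n + 1) t) (U : T.Opens)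

/-- The sections of `ℒ = ⋀^(n+1) ℰ_0 ⊗ (⋀^(n+1) ℰ_{-1})^∨` over an affine open `U`. -/
abbrev L : Type :=
  (⋀[F.Base U]^(n + 1) (F.E U 0)) ⊗[F.Base U]
    Module.Dual (F.Base U) (⋀[F.Base U]^(n + 1) (F.E U (-1)))

/-- The sections of `ℰ_{-1} ⊗ ℒ` over an affine open `U`. -/
abbrev EL : Type := F.E U (-1) ⊗[F.Base U] F.L U

/-- The sections of the trivial bundle with fibre `S_n V` over an affine open `U`. -/
abbrev SV : Type := F.Base U ⊗[ℂ] Sym n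

/-- The linear map `e ↦ e ∧ v₁ ∧ ⋯ ∧ vₙ`. -/
def wedge (v : Fin n → F.E U (-1)) :
    F.E U (-1) →ₗ[F.Base U] ⋀[F.Base U]^(n + 1) (F.E U (-1)) where
  toFun e := exteriorPower.ιMulti (F.Base U) (n + 1) (Fin.cons e v)
  map_add' e e' :=
    MultilinearMap.cons_add (exteriorPower.ιMulti (F.Base U) (n + 1)).toMultilinearMap v e e'
  map_smul' a e :=
    MultilinearMap.cons_smul (exteriorPower.ιMulti (F.Base U) (n + 1)).toMultilinearMap v a e

/-- The contraction `ℰ_{-1} ⊗ ℒ → ⋀^(n+1) ℰ_0`, `e ⊗ (d ⊗ θ) ↦ θ(e ∧ v₁ ∧ ⋯ ∧ vₙ) d`, for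
`v₁, …, vₙ ∈ ℰ_{-1}`. As `v` varies, these contractions make up the natural isomorphism
`ℰ_{-1} ⊗ ℒ ≅ Hom(⋀^n ℰ_{-1}, ⋀^(n+1) ℰ_0)`. -/
def contract (v : Fin n → F.E U (-1)) :
    F.EL U →ₗ[F.Base U] ⋀[F.Base U]^(n + 1) (F.E U 0) :=
  TensorProduct.lift
    (LinearMap.llcomp (F.Base U) (F.L U) _ _ (TensorProduct.rid (F.Base U) _).toLinearMap ∘ₗ
      LinearMap.lTensorHom (⋀[F.Base U]^(n + 1) (F.E U 0)) ∘ₗ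
      Module.Dual.eval (F.Base U) (⋀[F.Base U]^(n + 1) (F.E U (-1))) ∘ₗ F.wedge U v)

lemma contract_tmul (v : Fin n → F.E U (-1)) (e : F.E U (-1))
    (d : ⋀[F.Base U]^(n + 1) (F.E U 0))
    (θ : Module.Dual (F.Base U) (⋀[F.Base U]^(n + 1) (F.E U (-1)))) :
    F.contract U v (e ⊗ₜ (d ⊗ₜ θ)) =
      θ (exteriorPower.ιMulti (F.Base U) (n + 1) (Fin.cons e v)) • d := by
  simp [contract, wedge]

/-- `p` is (over the affine open `U`) the natural bundle map `S_n V → ℰ_{-1} ⊗ ℒ` given by the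
maximal minors of the multiplication maps `m_ℓ : ℰ_{-1} → ℱ = ℰ_0 / 𝒪`, `ℓ ∈ V`. These minors are
`⋀^n m_ℓ ∈ Hom(⋀^n ℰ_{-1}, ⋀^n ℱ) = ℰ_{-1} ⊗ ℒ`, where `⋀^n ℱ = ⋀^(n+1) ℰ_0` by `ω ↦ 1 ∧ ω`. They
depend on `ℓ` as a homogeneous polynomial of degree `n`, hence define a linear map on
`S_n V = (S_n V^∨)^∨`, in which `ℓ ^ n` is the evaluation at `ℓ`: it sends `ℓ ^ n` to `⋀^n m_ℓ`. -/
def IsMinorMap (p : F.SV U →ₗ[F.Base U] F.EL U) : Prop :=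
  ∀ (ℓ : Sym 1) (v : Fin n → F.E U (-1)),
    F.contract U v (p (1 ⊗ₜ powForm n ℓ)) =
      exteriorPower.ιMulti (F.Base U) (n + 1)
        (Fin.cons (F.one U) fun i => F.mulForm U ℓ (v i))

end Family

end DarbouxBundle
end

noncomputable section

namespace DarbouxBundle

/-! ### Polynomial curves and polarization -/

/-! Over an affine open with ring `R`, let `B` be the sections of `ℰ_0`, that is, the functions on
`Z`, and `N` those of `ℰ_{-1}`; both are finite projective of rank `n + 1`. If `e_j`, `f_j` is a
dual basis of `N` and `g` an alternating `n`-form on `N`, then `∑ ι_{e_j} (f_j ∧ g) = (tr id - n) g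
= g`. Hence `g ↦ ∑ e_j ⊗ (f_j ∧ g)` inverts the contraction, and `ℰ_{-1} ⊗ ℒ` is the module of
`n`-forms on `N` with values in `⋀^(n+1) B` (`contraction_bijective`).

The minor `1 ∧ ℓ v₁ ∧ ⋯ ∧ ℓ vₙ` is the diagonal of a map multilinear in `n` linear forms, so it
extends to `S_n V` (`exists_linearMap_powForm`), uniquely because powers span (`span_powForm`).

Surjectivity is checked at each maximal ideal. A line `ℓ₀` missing the finite fibre is invertible on
`Z` nearby, so every `(n+1)`-form on `N` is locally a multiple of `ℓ₀ v₀ ∧ ⋯ ∧ ℓ₀ vₙ`. By the dual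
basis formula the `n`-forms are then generated by the `b ∧ ℓ₀ v₁ ∧ ⋯ ∧ ℓ₀ vₙ` with `b ∈ B`.
Contracting the top form of `ℓ₀ + t ℓ` yields these inductively for `b = (ℓ / ℓ₀) ^ k`
(`minor_pow_mem_saturation`); polarization passes to all monomials in the ratios, and the ratios
generate `B` locally (`exists_local`).

Rank one quotients pull back along a surjection. The punctual statement combines a finite geometric
series with the same polarization. -/

/-- The coefficients of a polynomial curve lie in any subspace containing its points. -/
lemma coeff_mem_of_forall_sum_pow_smul_mem {X : Type*} [AddCommGroup X] [Module ℂ X]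
    (P : Submodule ℂ X) (N : ℕ) (z : ℕ → X)
    (h : ∀ t : ℂ, t ≠ 0 → ∑ j ∈ Finset.range N, t ^ j • z j ∈ P) {j : ℕ} (hj : j < N) :
    z j ∈ P := by
  -- A functional on the quotient by `P` turns the curve into a scalar polynomial that vanishes at
  -- every `t ≠ 0`, hence identically. Omitting `t = 0` is what later permits a passage to the
  -- limit.
  rw [← Submodule.Quotient.mk_eq_zero, ← Module.forall_dual_apply_eq_zero_iff ℂ]
  intro φ
  let q : Polynomial ℂ := ∑ i ∈ Finset.range N, Polynomial.monomial i (φ (P.mkQ (z i)))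
  have hq : q = 0 := by
    refine Polynomial.eq_zero_of_infinite_isRoot _
      (Set.Infinite.mono ?_ (Set.infinite_univ.sdiff (Set.finite_singleton (0 : ℂ))))
    intro t ht
    have h1 : φ (P.mkQ (∑ j ∈ Finset.range N, t ^ j • z j)) = 0 := by
      rw [Submodule.mkQ_apply, (Submodule.Quotient.mk_eq_zero P).2 (h t ht.2), map_zero]
    simpa [q, Polynomial.IsRoot, Polynomial.eval_finsetSum, Polynomial.eval_monomial, mul_comm]
      using h1
  have := congrArg (fun r => Polynomial.coeff r j) hq
  simpa [q, Polynomial.finsetSum_coeff, Polynomial.coeff_monomial, hj] using this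

/-- The coefficient of `t ^ j` is `m.choose j` times the wanted element, and binomial coefficients
are invertible in `ℂ`. The factor `q` allows the lemma to be applied to one variable at a time. -/
lemma pow_mul_pow_mul_mem {A : Type*} [CommRing A] [Algebra ℂ A] (P : Submodule ℂ A) {w y q : A}
    {m : ℕ} (h : ∀ t : ℂ, (w + t • y) ^ m * q ∈ P) {i j : ℕ} (hij : i + j = m) :
    w ^ i * y ^ j * q ∈ P := by
  have h1 := coeff_mem_of_forall_sum_pow_smul_mem P (m + 1)
    (fun k => (m.choose k : ℂ) • (w ^ (m - k) * y ^ k * q)) (j := j) (fun t _ => by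
      convert h t
      rw [add_comm w, add_pow, Finset.sum_mul]
      refine Finset.sum_congr rfl fun k _ => ?_
      simp only [Algebra.smul_def, mul_pow, map_natCast, map_pow]
      ring) (by lia)
  have h2 : (m.choose j : ℂ) ≠ 0 := by
    exact_mod_cast (Nat.choose_pos (by lia)).ne'
  rw [show i = m - j by lia]
  simpa [smul_smul, inv_mul_cancel₀ h2] using P.smul_mem (m.choose j : ℂ)⁻¹ h1

/-- Polarization: a subspace containing the `m`-th powers of all linear combinations of `x`, `y`,
`z` contains all monomials of degree `m` in `x`, `y`, `z`. -/
lemma monomial_mem_of_forall_pow_mem {A : Type*} [CommRing A] [Algebra ℂ A] (P : Submodule ℂ A)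
    {x y z : A} {m : ℕ} (h : ∀ a b c : ℂ, (a • x + b • y + c • z) ^ m ∈ P) {i j k : ℕ}
    (hijk : i + j + k = m) : x ^ i * y ^ j * z ^ k ∈ P := by
  refine pow_mul_pow_mul_mem P (m := i + j) (fun b => ?_) rfl
  -- This splits off `z ^ k`, which then plays the role of `q` when `x` and `y` are separated.
  have := pow_mul_pow_mul_mem P (w := x + b • y) (y := z) (q := 1) (m := m)
    (fun c => by simpa using h 1 b c) hijk
  simpa using this

lemma monomial_eq_pow (α : Fin 3 →₀ ℕ) : MvPolynomial.monomial α (1 : ℂ) =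
    MvPolynomial.X 0 ^ α 0 * MvPolynomial.X 1 ^ α 1 * MvPolynomial.X 2 ^ α 2 := by
  rw [MvPolynomial.monomial_eq, Finsupp.prod_fintype _ _ (by simp)]
  simp [Fin.prod_univ_three]

/-- The linear form with given coefficients. -/
def linForm (a : Fin 3 → ℂ) : Sym 1 := ∑ i, a i • coord i

lemma coe_linForm (a : Fin 3 → ℂ) :
    (linForm a : MvPolynomial (Fin 3) ℂ) = ∑ i, a i • MvPolynomial.X i := by
  simp [linForm, coord]

lemma exists_eq_linForm (ℓ : Sym 1) : ∃ a, ℓ = linForm a := by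
  have h : (ℓ : MvPolynomial (Fin 3) ℂ) ∈ MvPolynomial.homogeneousSubmodule (Fin 3) ℂ 1 := ℓ.2
  rw [MvPolynomial.homogeneousSubmodule_one_eq_span_X, Submodule.mem_span_range_iff_exists_fun] at h
  obtain ⟨a, ha⟩ := h
  exact ⟨a, Subtype.ext (by rw [coe_linForm, ha])⟩

/-- The powers of linear forms span `S_n V`. -/
lemma span_powForm (n : ℕ) : Submodule.span ℂ (Set.range (powForm n)) = ⊤ := by
  set P := (Submodule.span ℂ (Set.range (powForm n))).map (Sym n).subtype with hP
  have hmon : ∀ i j k, i + j + k = n →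
      (MvPolynomial.X 0 ^ i * MvPolynomial.X 1 ^ j * MvPolynomial.X 2 ^ k :
        MvPolynomial (Fin 3) ℂ) ∈ P := fun i j k => by
    refine monomial_mem_of_forall_pow_mem P fun a b c => ?_
    refine ⟨powForm n (linForm ![a, b, c]), Submodule.subset_span ⟨_, rfl⟩, ?_⟩
    simp [powForm, coe_linForm, Fin.sum_univ_three]
  rw [eq_top_iff]
  rintro f -
  have hf : (f : MvPolynomial (Fin 3) ℂ) ∈ P := by
    rw [(f : MvPolynomial (Fin 3) ℂ).as_sum]
    refine P.sum_mem fun α hα => ?_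
    have hd : α.degree = n := by
      by_contra hd
      exact (MvPolynomial.mem_support_iff.1 hα)
        ((show MvPolynomial.IsHomogeneous (f : MvPolynomial (Fin 3) ℂ) n from f.2).coeff_eq_zero hd)
    have := P.smul_mem (MvPolynomial.coeff α (f : MvPolynomial (Fin 3) ℂ))
      (hmon (α 0) (α 1) (α 2) (by
        rw [← hd, Finsupp.degree_eq_sum, Fin.sum_univ_three]))
    rwa [← monomial_eq_pow, MvPolynomial.smul_monomial, smul_eq_mul, mul_one] at this
  obtain ⟨g, hg, hgf⟩ := hf
  rwa [← Subtype.ext hgf]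

/-! ### Contractions of alternating maps -/

section Contraction

variable {R N D : Type*} [CommRing R] [AddCommGroup N] [Module R N] [AddCommGroup D] [Module R D]

lemma alternatingMap_sum_apply {κ ι : Type*} (s : Finset κ) (g : κ → N [⋀^ι]→ₗ[R] D) (v : ι → N) :
    (∑ j ∈ s, g j) v = ∑ j ∈ s, g j v :=
  map_sum (⟨⟨fun g => g v, rfl⟩, fun _ _ => rfl⟩ : (N [⋀^ι]→ₗ[R] D) →+ D) g s

/-- The wedge product `f ∧ g` of a linear form and an alternating map. -/
def formWedge {k : ℕ} (f : Module.Dual R N) : (N [⋀^Fin k]→ₗ[R] D) →ₗ[R] N [⋀^Fin (k + 1)]→ₗ[R] D where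
  toFun g := AlternatingMap.alternatizeUncurryFin (LinearMap.smulRight f g)
  map_add' g g' := by
    ext v; simp [AlternatingMap.alternatizeUncurryFin_apply, Finset.sum_add_distrib]
  map_smul' a g := by
    ext v; simp [AlternatingMap.alternatizeUncurryFin_apply, Finset.smul_sum, smul_comm a]

lemma formWedge_apply {k : ℕ} (f : Module.Dual R N) (g : N [⋀^Fin k]→ₗ[R] D) (v : Fin (k + 1) → N) :
    formWedge f g v = ∑ i : Fin (k + 1), (-1) ^ (i : ℕ) • f (v i) • g (i.removeNth v) := by
  simp [formWedge, AlternatingMap.alternatizeUncurryFin_apply]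

/-- Contraction is an antiderivation: in `(f ∧ g)(e, v)` the term of index `0` is `f e • g v`, and
the shift of the other indices by one changes their sign. -/
lemma formWedge_curryLeft {k : ℕ} (f : Module.Dual R N) (g : N [⋀^Fin (k + 1)]→ₗ[R] D) (e : N) :
    formWedge f (g.curryLeft e) = f e • g - (formWedge f g).curryLeft e := by
  ext v
  simp only [AlternatingMap.sub_apply, AlternatingMap.smul_apply,
    AlternatingMap.curryLeft_apply_apply, formWedge_apply]
  conv_rhs => rw [Fin.sum_univ_succ]
  simp only [Matrix.vecCons, Fin.val_zero, pow_zero, one_smul, Fin.cons_zero, Fin.removeNth_zero,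
    Fin.tail_cons, Fin.val_succ, Fin.cons_succ]
  rw [sub_add_cancel_left, ← Finset.sum_neg_distrib]
  refine Finset.sum_congr rfl fun i _ => ?_
  have : (i.succ.removeNth (Fin.cons e v : Fin (k + 2) → N) : Fin (k + 1) → N) =
      Fin.cons e (i.removeNth v) := by
    funext j
    refine Fin.cases ?_ (fun j => ?_) j <;> simp [Fin.removeNth]
  rw [this, pow_succ, mul_neg_one, neg_smul, neg_neg]

variable {ι : Type*} [Fintype ι] {e : ι → N} {f : ι → Module.Dual R N}

/-- The scalar `∑ f_j (e_j)` is the trace of the identity, so for rank `k + 1` the right side is `g`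
itself. -/
lemma sum_formWedge_curryLeft (hef : ∀ v, ∑ j, f j v • e j = v) {k : ℕ} (g : N [⋀^Fin k]→ₗ[R] D) :
    ∑ j, (formWedge (f j) g).curryLeft (e j) = (∑ j, f j (e j)) • g - k • g := by
  rcases k with _ | k
  · ext v
    simp [formWedge_apply, alternatingMap_sum_apply, Finset.sum_smul, Subsingleton.elim _ v]
  · have h1 : ∀ j, (formWedge (f j) g).curryLeft (e j) =
        f j (e j) • g - formWedge (f j) (g.curryLeft (e j)) := fun j => by
      rw [formWedge_curryLeft]; abel
    simp_rw [h1, Finset.sum_sub_distrib, ← Finset.sum_smul]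
    congr 1
    -- Euler's identity: wedging each `ι_{e_j} g` with `f_j` and summing gives the degree `k + 1`
    -- times `g`.
    rw [← AlternatingMap.alternatizeUncurryFin_curryLeft]
    ext v
    simp only [alternatingMap_sum_apply, formWedge_apply,
      AlternatingMap.alternatizeUncurryFin_apply]
    rw [Finset.sum_comm]
    refine Finset.sum_congr rfl fun i _ => ?_
    rw [← Finset.smul_sum]
    congr 1
    conv_rhs => rw [← hef (v i)]
    simp [map_sum, alternatingMap_sum_apply]

/-- A dual basis of a finite projective module. -/
lemma exists_dual_basis (R N : Type*) [CommRing R] [AddCommGroup N] [Module R N]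
    [Module.Finite R N] [Module.Projective R N] :
    ∃ (k : ℕ) (e : Fin k → N) (f : Fin k → Module.Dual R N), ∀ v, ∑ j, f j v • e j = v := by
  obtain ⟨k, a, b, -, -, hab⟩ := Module.Finite.exists_comp_eq_id_of_projective R N
  refine ⟨k, fun j => a (Pi.single j 1), fun j => LinearMap.proj j ∘ₗ b, fun v => ?_⟩
  conv_rhs => rw [← LinearMap.id_apply (R := R) v, ← hab, LinearMap.comp_apply,
    ← Finset.univ_sum_single (b v), map_sum]
  refine Finset.sum_congr rfl fun j _ => ?_
  rw [← map_smul, ← Pi.single_smul]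
  simp

/-- A dual basis provides the inverse `g ↦ ∑ f_j ⊗ g (e_j)`. -/
lemma dualTensorHom_bijective (R M D : Type*) [CommRing R] [AddCommGroup M] [Module R M]
    [AddCommGroup D] [Module R D] [Module.Finite R M] [Module.Projective R M] :
    Function.Bijective (dualTensorHom R M D) := by
  obtain ⟨k, e, f, hef⟩ := exists_dual_basis R M
  refine Function.bijective_iff_has_inverse.2
    ⟨fun g => ∑ j, f j ⊗ₜ g (e j), fun z => ?_, fun g => ?_⟩
  · induction z with
    | zero => simp
    | add x y hx hy => simpa [TensorProduct.tmul_add, Finset.sum_add_distrib] using congr($hx + $hy)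
    | tmul θ d =>
      simp only [dualTensorHom_apply, TensorProduct.tmul_smul, TensorProduct.smul_tmul']
      rw [← TensorProduct.sum_tmul]
      congr 1
      ext v
      conv_rhs => rw [← hef v, map_sum]
      simp [mul_comm]
  · ext v
    simp only [map_sum, LinearMap.sum_apply, dualTensorHom_apply]
    conv_rhs => rw [← hef v, map_sum]
    simp

/-- A retraction of a finite free module onto `M` induces one of its exterior power onto `⋀^k M`. -/
instance exteriorPower_projective (R M : Type*) [CommRing R] [AddCommGroup M] [Module R M]
    [Module.Finite R M] [Module.Projective R M] (k : ℕ) : Module.Projective R (⋀[R]^k M) := by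
  obtain ⟨m, a, b, -, -, hab⟩ := Module.Finite.exists_comp_eq_id_of_projective R M
  refine Module.Projective.of_split (exteriorPower.map k b) (exteriorPower.map k a) ?_
  rw [← exteriorPower.map_comp, hab, exteriorPower.map_id]

variable (R N D) in
/-- `D ⊗ (⋀^k N)^∨` maps to the alternating maps from `N` to `D`. -/
def tensorDualToAlternating (k : ℕ) :
    D ⊗[R] Module.Dual R (⋀[R]^k N) →ₗ[R] N [⋀^Fin k]→ₗ[R] D :=
  exteriorPower.alternatingMapLinearEquiv.symm.toLinearMap ∘ₗ dualTensorHom R _ D ∘ₗ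
    (TensorProduct.comm R D _).toLinearMap

lemma tensorDualToAlternating_tmul {k : ℕ} (d : D) (θ : Module.Dual R (⋀[R]^k N)) (v : Fin k → N) :
    tensorDualToAlternating R N D k (d ⊗ₜ θ) v = θ (exteriorPower.ιMulti R k v) • d := by
  simp [tensorDualToAlternating]

lemma tensorDualToAlternating_bijective (k : ℕ) [Module.Finite R N] [Module.Projective R N] :
    Function.Bijective (tensorDualToAlternating R N D k) := by
  simp only [tensorDualToAlternating, LinearMap.coe_comp, LinearEquiv.coe_coe]
  exact (LinearEquiv.bijective _).comp ((dualTensorHom_bijective R _ D).comp (LinearEquiv.bijective _))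

variable (R N D) in
/-- The contraction `e ⊗ (d ⊗ θ) ↦ (v ↦ θ(e ∧ v) d)`. -/
def contraction (k : ℕ) :
    N ⊗[R] (D ⊗[R] Module.Dual R (⋀[R]^(k + 1) N)) →ₗ[R] N [⋀^Fin k]→ₗ[R] D :=
  TensorProduct.lift
    (AlternatingMap.curryLeftLinearMap ∘ₗ tensorDualToAlternating R N D (k + 1)).flip

lemma contraction_tmul {k : ℕ} (e : N) (l : D ⊗[R] Module.Dual R (⋀[R]^(k + 1) N)) :
    contraction R N D k (e ⊗ₜ l) = (tensorDualToAlternating R N D (k + 1) l).curryLeft e := rfl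

/-- For a finite projective module of rank `k + 1`, `N ⊗ (D ⊗ (⋀^(k+1) N)^∨)` is the module of
alternating maps in `k` variables. -/
lemma contraction_bijective {k : ℕ} [Module.Finite R N] [Module.Projective R N]
    (hef : ∀ v, ∑ j, f j v • e j = v) (htr : ∑ j, f j (e j) = ((k + 1 : ℕ) : R))
    (hvan : ∀ h : N [⋀^Fin (k + 2)]→ₗ[R] D, h = 0) :
    Function.Bijective (contraction R N D k) := by
  let J := LinearEquiv.ofBijective _ (tensorDualToAlternating_bijective (R := R) (N := N) (D := D) (k + 1))
  have hJ : ∀ h, tensorDualToAlternating R N D (k + 1) (J.symm h) = h := J.apply_symm_apply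
  have hJ' : ∀ l, J.symm (tensorDualToAlternating R N D (k + 1) l) = l := J.symm_apply_apply
  refine Function.bijective_iff_has_inverse.2
    -- The rank enters twice. That `f_j ∧ h = 0` for top forms `h` makes this a left inverse, by the
    -- antiderivation rule; that the trace is `k + 1` makes it a right inverse.
    ⟨fun g => ∑ j, e j ⊗ₜ J.symm (formWedge (f j) g), fun z => ?_, fun g => ?_⟩
  · induction z with
    | zero => simp
    | add x y hx hy => simpa [TensorProduct.tmul_add, Finset.sum_add_distrib] using congr($hx + $hy)
    | tmul w l =>
      simp only [contraction_tmul, formWedge_curryLeft]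
      conv_rhs => rw [← hef w, TensorProduct.sum_tmul]
      refine Finset.sum_congr rfl fun j _ => ?_
      rw [hvan (formWedge (f j) _), AlternatingMap.curryLeft_zero, LinearMap.zero_apply, sub_zero,
        map_smul, hJ', TensorProduct.tmul_smul, TensorProduct.smul_tmul']
  · simp only [map_sum, contraction_tmul, hJ]
    rw [sum_formWedge_curryLeft hef, htr]
    ext v
    simp [add_smul, Nat.cast_smul_eq_nsmul]

end Contraction

/-! ### Local arguments at the maximal ideals -/

section Local

variable {R M D : Type*} [CommRing R] [AddCommGroup M] [Module R M] [AddCommGroup D] [Module R D]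

/-- The `r` with `r • x ∈ P` form an ideal contained in no maximal ideal, so it contains `1`. Local
membership can thus be expressed by a multiplier outside `m`. -/
lemma mem_of_forall_isMaximal (P : Submodule R M) (x : M)
    (h : ∀ m : Ideal R, m.IsMaximal → ∃ r ∉ m, r • x ∈ P) : x ∈ P := by
  by_contra hx
  have hne : P.comap (LinearMap.toSpanSingleton R M x) ≠ ⊤ := fun htop => hx <| by
    have : (1 : R) ∈ P.comap (LinearMap.toSpanSingleton R M x) := htop ▸ Submodule.mem_top
    simpa using this
  obtain ⟨m, hm, hle⟩ := Ideal.exists_le_maximal _ hne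
  obtain ⟨r, hr, hrx⟩ := h m hm
  exact hr (hle (by simpa using hrx))

lemma eq_zero_of_forall_isMaximal (x : M)
    (h : ∀ m : Ideal R, m.IsMaximal → ∃ r ∉ m, r • x = 0) : x = 0 := by
  simpa using mem_of_forall_isMaximal ⊥ x (by simpa using h)

/-- The elements which are in `P` locally at `m`. -/
def saturation (m : Ideal R) [hm : m.IsPrime] (P : Submodule R M) : Submodule R M where
  carrier := {x | ∃ r ∉ m, r • x ∈ P}
  zero_mem' := ⟨1, m.one_notMem, by simp⟩
  add_mem' := by
    rintro x y ⟨r, hr, hx⟩ ⟨q, hq, hy⟩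
    refine ⟨r * q, hm.mul_notMem hr hq, ?_⟩
    rw [smul_add]
    refine P.add_mem ?_ ?_
    · rw [mul_comm, mul_smul]; exact P.smul_mem _ hx
    · rw [mul_smul]; exact P.smul_mem _ hy
  smul_mem' := by
    rintro a x ⟨r, hr, hx⟩
    exact ⟨r, hr, by rw [smul_comm]; exact P.smul_mem _ hx⟩

lemma mem_saturation {m : Ideal R} [m.IsPrime] {P : Submodule R M} {x : M} :
    x ∈ saturation m P ↔ ∃ r ∉ m, r • x ∈ P := Iff.rfl

lemma le_saturation (m : Ideal R) [m.IsPrime] (P : Submodule R M) : P ≤ saturation m P :=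
  fun x hx => ⟨1, m.one_notMem, by simpa⟩

lemma mem_saturation_of_smul_mem {m : Ideal R} [hm : m.IsPrime] {P : Submodule R M} {x : M} {r : R}
    (hr : r ∉ m) (h : r • x ∈ saturation m P) : x ∈ saturation m P := by
  obtain ⟨q, hq, hx⟩ := h
  exact ⟨q * r, hm.mul_notMem hq hr, by rwa [mul_smul]⟩

/-- At any maximal ideal, a finitely generated module which is generated locally by a finite family is
generated by it after multiplication with one scalar. -/
lemma exists_forall_smul_mem_of_fg [Module.Finite R M] (m : Ideal R) [hm : m.IsPrime]
    (P : Submodule R M) (h : ∀ x, x ∈ saturation m P) : ∃ r ∉ m, ∀ x : M, r • x ∈ P := by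
  classical
  obtain ⟨s, hs⟩ := Module.Finite.fg_top (R := R) (M := M)
  choose r hr hrx using h
  have hmem : ∏ x ∈ s, r x ∉ m := by
    rw [hm.prod_mem_iff]
    rintro ⟨x, -, hx⟩
    exact hr x hx
  refine ⟨_, hmem, fun x => ?_⟩
  have hx : x ∈ Submodule.span R (s : Set M) := hs ▸ Submodule.mem_top
  induction hx using Submodule.span_induction with
  | mem x hx =>
    rw [← Finset.mul_prod_erase _ _ hx, mul_comm, mul_smul]
    exact P.smul_mem _ (hrx x)
  | zero => simp
  | add x y _ _ hx hy => rw [smul_add]; exact P.add_mem hx hy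
  | smul a x _ hx => rw [smul_comm]; exact P.smul_mem _ hx

/-- The localization at `m` is free of rank `k`. The numerators of a basis still generate it, and
finite generation merges the denominators into one scalar. -/
lemma exists_smul_mem_span_of_rankAtStalk [Module.Finite R M] [Module.Flat R M] (m : Ideal R)
    [hm : m.IsPrime] {k : ℕ} (hk : Module.rankAtStalk M ⟨m, hm⟩ = k) :
    ∃ r ∉ m, ∃ b : Fin k → M, ∀ x, r • x ∈ Submodule.span R (Set.range b) := by
  let A := Localization.AtPrime m
  let f := LocalizedModule.mkLinearMap m.primeCompl M
  have : Module.Free A (LocalizedModule m.primeCompl M) := Module.free_of_flat_of_isLocalRing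
  let c : Module.Basis (Fin k) A (LocalizedModule m.primeCompl M) :=
    Module.finBasisOfFinrankEq _ _ hk
  choose bs hbs using fun i => IsLocalizedModule.surj m.primeCompl f (c i)
  let b : Fin k → M := fun i => (bs i).1
  have htop : Submodule.span A (f '' Set.range b) = ⊤ := by
    rw [eq_top_iff, ← c.span_eq, Submodule.span_le]
    rintro _ ⟨i, rfl⟩
    have hu : IsUnit (algebraMap R A (bs i).2) := IsLocalization.map_units A (bs i).2
    have h1 : algebraMap R A (bs i).2 • c i ∈ Submodule.span A (f '' Set.range b) := by
      rw [algebraMap_smul]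
      have := hbs i
      rw [Submonoid.smul_def] at this
      rw [this]
      exact Submodule.subset_span ⟨_, ⟨i, rfl⟩, rfl⟩
    exact (Submodule.smul_mem_iff_of_isUnit _ hu).1 h1
  have hloc : ∀ x, x ∈ saturation m (Submodule.span R (Set.range b)) := fun x => by
    have hx : f x ∈ (Submodule.span R (Set.range b)).localized' A m.primeCompl f := by
      rw [Submodule.localized'_span, htop]; trivial
    obtain ⟨y, hy, s, hys⟩ := hx
    have hys : f y = f ((s : R) • x) := by
      rw [map_smul]; exact IsLocalizedModule.mk'_eq_iff.1 hys
    rw [IsLocalizedModule.eq_iff_exists m.primeCompl f] at hys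
    obtain ⟨t, ht⟩ := hys
    refine ⟨t * s, hm.mul_notMem t.2 s.2, ?_⟩
    rw [mul_smul]
    simp only [Submonoid.smul_def] at ht
    rw [← ht]
    exact Submodule.smul_mem _ _ hy
  obtain ⟨r, hr, h⟩ := exists_forall_smul_mem_of_fg m _ hloc
  exact ⟨r, hr, b, h⟩

/-- Both sides are alternating in the rows of `A`, so it suffices to compare them on permutations of
the standard basis of `R ^ k`; `b` may be any family. -/
lemma alternatingMap_apply_sum_smul {k : ℕ} (h : M [⋀^Fin k]→ₗ[R] D) (b : Fin k → M)
    (A : Matrix (Fin k) (Fin k) R) : (h fun i => ∑ j, A i j • b j) = A.det • h b := by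
  have key : h.compLinearMap (Fintype.linearCombination R b) =
      (LinearMap.toSpanSingleton R D (h b)).compAlternatingMap Matrix.detRowAlternating := by
    refine Module.Basis.ext_alternating (Pi.basisFun R (Fin k)) fun v hv => ?_
    let σ := Equiv.ofBijective v (Finite.injective_iff_bijective.1 hv)
    have h1 : ∀ g : (Fin k → R) [⋀^Fin k]→ₗ[R] D, (g fun i => Pi.basisFun R (Fin k) (v i)) =
        Equiv.Perm.sign σ • g (Pi.basisFun R (Fin k)) := fun g =>
      g.map_perm (Pi.basisFun R (Fin k)) σ
    rw [h1, h1]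
    congr 1
    have h2 : Matrix.detRowAlternating (R := R) (fun i => Pi.basisFun R (Fin k) i) = 1 := by
      have h3 : (fun i => Pi.basisFun R (Fin k) i) = (1 : Matrix (Fin k) (Fin k) R) := by
        ext i j
        simp [Matrix.one_apply, Pi.single_apply, eq_comm]
      rw [h3]
      exact Matrix.det_one
    simp only [AlternatingMap.compLinearMap_apply, LinearMap.compAlternatingMap_apply, h2]
    simp [Fintype.linearCombination_apply, Pi.single_apply]
  exact congr($key fun i => A i)

lemma alternatingMap_eq_zero_of_span {k : ℕ} (h : M [⋀^Fin (k + 1)]→ₗ[R] D) (b : Fin k → M)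
    (v : Fin (k + 1) → M) (hv : ∀ i, v i ∈ Submodule.span R (Set.range b)) : h v = 0 := by
  have key : h.compLinearMap (Fintype.linearCombination R b) = 0 := by
    -- After pullback to `R ^ k` only injective families of basis vectors matter, and `Fin (k + 1)`
    -- does not inject into `Fin k`.
    refine Module.Basis.ext_alternating (Pi.basisFun R (Fin k)) fun v hv => ?_
    have := Fintype.card_le_of_injective v hv
    simp at this
  simp_rw [Submodule.mem_span_range_iff_exists_fun] at hv
  choose A hA using hv
  simpa [Fintype.linearCombination_apply, hA] using congr($key A)

/-- Alternating maps in more variables than the rank vanish. -/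
lemma alternatingMap_eq_zero {k : ℕ} (hspan : ∀ m : Ideal R, m.IsMaximal → ∃ r ∉ m,
      ∃ b : Fin k → M, ∀ x, r • x ∈ Submodule.span R (Set.range b))
    (h : M [⋀^Fin (k + 1)]→ₗ[R] D) : h = 0 := by
  ext v
  refine eq_zero_of_forall_isMaximal (R := R) _ fun m hm => ?_
  obtain ⟨r, hr, b, hb⟩ := hspan m hm
  refine ⟨r ^ (k + 1), fun hmem => hr (hm.isPrime.mem_of_pow_mem _ hmem), ?_⟩
  have := alternatingMap_eq_zero_of_span h b (fun i => r • v i) fun i => hb (v i)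
  rw [← this, h.map_smul_univ (fun _ => r) v]
  simp

/-- The trace of a finite projective module of constant rank. -/
lemma sum_dual_basis {ι : Type*} [Fintype ι] [Module.Finite R M] [Module.Projective R M] {k : ℕ}
    {e : ι → M} {f : ι → Module.Dual R M} (hef : ∀ v, ∑ j, f j v • e j = v)
    (hrank : ∀ m : Ideal R, (hm : m.IsMaximal) → Module.rankAtStalk M ⟨m, hm.isPrime⟩ = k) :
    ∑ j, f j (e j) = (k : R) := by
  rw [← sub_eq_zero]
  refine eq_zero_of_forall_isMaximal (R := R) _ fun m hm => ?_
  have := hm.isPrime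
  let A := Localization.AtPrime m
  have : Module.Free A (A ⊗[R] M) := Module.free_of_flat_of_isLocalRing
  have hr := hrank m hm
  rw [Module.rankAtStalk_eq_finrank_tensorProduct] at hr
  -- The tensor `∑ f_j ⊗ e_j` represents the identity of the free localization, whose trace is `k`;
  -- the trace of a tensor is its contraction.
  have hid : dualTensorHom A (A ⊗[R] M) (A ⊗[R] M)
      (∑ j, Module.Dual.baseChange A (f j) ⊗ₜ
        ((1 : A) ⊗ₜ[R] e j)) = LinearMap.id := by
    refine TensorProduct.AlgebraTensorModule.ext fun a x => ?_
    simp only [map_sum, LinearMap.sum_apply, dualTensorHom_apply,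
      Module.Dual.baseChange_apply_tmul, LinearMap.id_apply]
    conv_rhs => rw [← hef x, TensorProduct.tmul_sum]
    refine Finset.sum_congr rfl fun j _ => ?_
    rw [TensorProduct.smul_tmul', smul_eq_mul, mul_one, TensorProduct.smul_tmul]
  have htr := congrArg (LinearMap.trace A (A ⊗[R] M)) hid
  rw [LinearMap.trace_eq_contract_apply, LinearMap.trace_id, hr] at htr
  have h0 : algebraMap R A (∑ j, f j (e j)) = algebraMap R A k := by
    simpa [Algebra.smul_def] using htr
  obtain ⟨c, hc⟩ := (IsLocalization.eq_iff_exists m.primeCompl A).1 h0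
  exact ⟨c, c.2, by rw [smul_eq_mul, mul_sub, hc, sub_self]⟩

/-- At `m` the scalar `s` is a unit, and `s⁻¹ g` is inverse to `f`. -/
lemma rankAtStalk_eq_of_comp_eq_smul {M' : Type*} [AddCommGroup M'] [Module R M'] (m : Ideal R)
    [hm : m.IsPrime] {s : R} (hs : s ∉ m) (f : M →ₗ[R] M') (g : M' →ₗ[R] M)
    (hgf : ∀ x, g (f x) = s • x) (hfg : ∀ x, f (g x) = s • x) :
    Module.rankAtStalk M ⟨m, hm⟩ = Module.rankAtStalk M' ⟨m, hm⟩ := by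
  rw [Module.rankAtStalk_eq_finrank_tensorProduct, Module.rankAtStalk_eq_finrank_tensorProduct]
  let A := Localization.AtPrime m
  obtain ⟨u, hu⟩ : IsUnit (algebraMap R A s) := IsLocalization.map_units A (⟨s, hs⟩ : m.primeCompl)
  refine LinearEquiv.finrank_eq (LinearEquiv.ofLinearMap (f.baseChange A)
    ((↑u⁻¹ : A) • g.baseChange A) ?_ ?_)
  · refine TensorProduct.AlgebraTensorModule.ext fun a x => ?_
    simp only [LinearMap.comp_apply, LinearMap.smul_apply, LinearMap.baseChange_tmul, map_smul, hfg,
      LinearMap.id_apply, ← TensorProduct.smul_tmul, Algebra.smul_def, ← hu]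
    rw [TensorProduct.smul_tmul', smul_eq_mul, Units.inv_mul_cancel_left]
  · refine TensorProduct.AlgebraTensorModule.ext fun a x => ?_
    simp only [LinearMap.comp_apply, LinearMap.smul_apply, LinearMap.baseChange_tmul, hgf,
      LinearMap.id_apply, ← TensorProduct.smul_tmul, Algebra.smul_def, ← hu]
    rw [TensorProduct.smul_tmul', smul_eq_mul, Units.inv_mul_cancel_left]

end Local

/-! ### Linear maps on `S_n V` -/

section Polynomial

variable {X : Type*} [AddCommGroup X] [Module ℂ X] {n : ℕ}

/-- The points of the diagonal of a multilinear map along a line form a polynomial curve. -/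
lemma exists_multilinear_add_smul (G : MultilinearMap ℂ (fun _ : Fin n => Sym 1) X) (ℓ₀ ℓ : Sym 1) :
    ∃ z : ℕ → X, ∀ t : ℂ, (G fun _ => ℓ₀ + t • ℓ) = ∑ j ∈ Finset.range (n + 1), t ^ j • z j := by
  refine ⟨fun j => ∑ s ∈ Finset.powersetCard j Finset.univ,
    G (s.piecewise (fun _ => ℓ) fun _ => ℓ₀), fun t => ?_⟩
  have h1 : (fun _ : Fin n => ℓ₀ + t • ℓ) = (fun _ => t • ℓ) + fun _ => ℓ₀ := by
    funext; simp [add_comm]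
  rw [h1, MultilinearMap.map_add_univ]
  have h2 : ∀ s : Finset (Fin n), G (s.piecewise (fun _ => t • ℓ) fun _ => ℓ₀) =
      t ^ s.card • G (s.piecewise (fun _ => ℓ) fun _ => ℓ₀) := fun s => by
    have := G.map_piecewise_smul (fun _ => t) (s.piecewise (fun _ => ℓ) fun _ => ℓ₀) s
    rw [Finset.prod_const] at this
    rw [← this]
    congr 1
    funext i
    by_cases hi : i ∈ s <;> simp [hi]
  simp_rw [h2]
  rw [← Finset.powerset_univ, Finset.sum_powerset]
  simp only [Finset.card_univ, Fintype.card_fin]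
  refine Finset.sum_congr rfl fun j _ => ?_
  rw [Finset.smul_sum]
  refine Finset.sum_congr rfl fun s hs => ?_
  rw [(Finset.mem_powersetCard.1 hs).2]

/-- A multilinear map on `V ^ n` induces a linear map on `S_n V` with the same diagonal. -/
lemma exists_linearMap_powForm (G : MultilinearMap ℂ (fun _ : Fin n => Sym 1) X) :
    ∃ p : Sym n →ₗ[ℂ] X, ∀ ℓ, p (powForm n ℓ) = G fun _ => ℓ := by
  classical
  let w : (Fin n → Fin 3) → (Fin 3 →₀ ℕ) := fun f => ∑ j, Finsupp.single (f j) 1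
  let S : (Fin 3 →₀ ℕ) → Finset (Fin n → Fin 3) := fun α => Finset.univ.filter fun f => w f = α
  -- `G` need not be symmetric, so a monomial is sent to the average of `G` over all words in the
  -- coordinates with that multidegree. A multidegree without words gets the value `0`.
  let q : MvPolynomial (Fin 3) ℂ →ₗ[ℂ] X := (MvPolynomial.basisMonomials (Fin 3) ℂ).constr ℂ
    fun α => ((S α).card : ℂ)⁻¹ • ∑ f ∈ S α, G fun j => coord (f j)
  have hq : ∀ α, q (MvPolynomial.monomial α 1) =
      ((S α).card : ℂ)⁻¹ • ∑ f ∈ S α, G fun j => coord (f j) := fun α => by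
    rw [← congrFun (MvPolynomial.coe_basisMonomials (Fin 3) ℂ) α, Module.Basis.constr_basis]
  refine ⟨q ∘ₗ (Sym n).subtype, fun ℓ => ?_⟩
  obtain ⟨a, rfl⟩ := exists_eq_linForm ℓ
  have h1 : (powForm n (linForm a) : MvPolynomial (Fin 3) ℂ) =
      ∑ f : Fin n → Fin 3, (∏ j, a (f j)) • MvPolynomial.monomial (w f) 1 := by
    simp only [powForm, coe_linForm]
    rw [← Fin.prod_const, Finset.prod_univ_sum]
    refine Finset.sum_congr (by simp) fun f _ => ?_
    simp only [MvPolynomial.smul_eq_C_mul, Finset.prod_mul_distrib, map_prod, w]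
    congr 1
    rw [MvPolynomial.monomial_sum_one]
    rfl
  have h2 : (G fun _ => linForm a) = ∑ f : Fin n → Fin 3, (∏ j, a (f j)) • G fun j => coord (f j) := by
    simp only [linForm]
    rw [MultilinearMap.map_sum]
    refine Finset.sum_congr rfl fun f _ => ?_
    rw [← MultilinearMap.map_smul_univ]
  -- The coefficient of a word depends only on its multidegree, so averaging over words does not
  -- change the sum on the diagonal.
  have hfib : ∀ z : (Fin n → Fin 3) → X, ∑ f, (∏ j, a (f j)) • z f =
      ∑ α ∈ Finset.univ.image w, ∑ f ∈ S α, (∏ i, a i ^ α i) • z f := fun z => by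
    rw [← Finset.sum_fiberwise_of_maps_to (s := Finset.univ) (t := Finset.univ.image w) (g := w)
      fun f _ => Finset.mem_image_of_mem _ (Finset.mem_univ f)]
    refine Finset.sum_congr rfl fun α _ => Finset.sum_congr rfl fun f hf => ?_
    rw [← (Finset.mem_filter.1 hf).2]
    congr 1
    simp only [w, Finsupp.finsetSum_apply, ← Finset.prod_pow_eq_pow_sum]
    rw [Finset.prod_comm]
    refine Finset.prod_congr rfl fun j _ => ?_
    rw [Finset.prod_eq_single (f j)] <;> simp +contextual
  simp only [LinearMap.comp_apply, Submodule.subtype_apply]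
  rw [h1, map_sum, h2]
  simp only [map_smul, hq]
  rw [hfib, hfib]
  refine Finset.sum_congr rfl fun α hα => ?_
  obtain ⟨f₀, -, hf₀⟩ := Finset.mem_image.1 hα
  have hne : ((S α).card : ℂ) ≠ 0 := by
    have : (S α).Nonempty := ⟨f₀, by simp [S, hf₀]⟩
    exact_mod_cast this.card_pos.ne'
  rw [← Finset.smul_sum, ← Finset.smul_sum]
  congr 1
  rw [Finset.sum_congr rfl (g := fun _ =>
    ((S α).card : ℂ)⁻¹ • ∑ f ∈ S α, G fun j => coord (f j)) fun f hf => by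
      rw [(Finset.mem_filter.1 hf).2], Finset.sum_const, ← Nat.cast_smul_eq_nsmul ℂ, smul_smul,
    mul_inv_cancel₀ hne, one_smul]

end Polynomial

/-- Linear maps on `R ⊗ S_n V` agree if they agree on the powers of linear forms. -/
lemma baseChange_sym_ext {R X : Type*} [CommRing R] [Algebra ℂ R] [AddCommGroup X] [Module R X]
    {n : ℕ} {p q : R ⊗[ℂ] Sym n →ₗ[R] X}
    (h : ∀ ℓ, p (1 ⊗ₜ powForm n ℓ) = q (1 ⊗ₜ powForm n ℓ)) : p = q := by
  have h1 : ∀ f : Sym n, p (1 ⊗ₜ f) = q (1 ⊗ₜ f) := fun f => by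
    have hf : f ∈ Submodule.span ℂ (Set.range (powForm n)) := span_powForm n ▸ Submodule.mem_top
    induction hf using Submodule.span_induction with
    | mem f hf => obtain ⟨ℓ, rfl⟩ := hf; exact h ℓ
    | zero => simp
    | add f g _ _ hf hg => simp [TensorProduct.tmul_add, hf, hg]
    | smul c f _ hf =>
      have h2 : (1 : R) ⊗ₜ[ℂ] (c • f) = algebraMap ℂ R c • (1 : R) ⊗ₜ[ℂ] f := by
        rw [algebraMap_smul, TensorProduct.tmul_smul]
      rw [h2, map_smul, map_smul, hf]
  ext z
  induction z with
  | zero => simp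
  | add x y hx hy => simp [hx, hy]
  | tmul r f =>
    have h2 : r ⊗ₜ[ℂ] f = r • (1 : R) ⊗ₜ[ℂ] f := by simp [TensorProduct.smul_tmul']
    rw [h2, map_smul, map_smul, h1]

/-! ### Minors of a linear system -/

/-- A family of pairings `N → B`, parametrized by the linear forms `ℓ ∈ V`, which behaves like the
multiplication `𝒪_Z(-1) → 𝒪_Z` by `ℓ` for a finite subscheme `Z` of the plane. -/
structure LinearForms (R B N : Type*) [CommRing R] [Algebra ℂ R] [CommRing B] [Algebra R B]
    [AddCommGroup N] [Module R N] [Module B N] [IsScalarTower R B N] where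
  mul : Sym 1 → N →ₗ[R] B
  mul_add_left : ∀ ℓ ℓ', mul (ℓ + ℓ') = mul ℓ + mul ℓ'
  mul_smul_left : ∀ (c : ℂ) ℓ, mul (c • ℓ) = algebraMap ℂ R c • mul ℓ
  mul_smul : ∀ ℓ (b : B) v, mul ℓ (b • v) = b * mul ℓ v
  mul_comm : ∀ ℓ v w, mul ℓ v • w = mul ℓ w • v
  -- Here `ℓ` stands for a line that misses the fibre over `m`, and `u` for `s / ℓ`. The elements
  -- `mul ℓ' u = s ℓ' / ℓ` generate the functions on `Z` near that fibre.
  exists_local : ∀ m : Ideal R, m.IsMaximal → ∃ s ∉ m, ∃ ℓ u, mul ℓ u = algebraMap R B s ∧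
    ∀ b : B, ∃ r ∉ m, r • b ∈ Algebra.adjoin R (Set.range fun ℓ' => mul ℓ' u)

namespace LinearForms

variable {R B N : Type*} [CommRing R] [Algebra ℂ R] [CommRing B] [Algebra R B]
  [AddCommGroup N] [Module R N] [Module B N] [IsScalarTower R B N] (Φ : LinearForms R B N)

include Φ in
-- The scalars `s = ℓ u` generate the unit ideal; write `∑ rᵢ sᵢ = 1`. Then `v ↦ (ℓᵢ v)ᵢ` is split
-- by `(bᵢ) ↦ ∑ rᵢ bᵢ uᵢ`, because `(ℓᵢ v) uᵢ = (ℓᵢ uᵢ) v`.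
lemma exists_retraction : ∃ (k : ℕ) (a : N →ₗ[R] Fin k → B) (b : (Fin k → B) →ₗ[R] N),
    b ∘ₗ a = LinearMap.id := by
  let S : Set R := {s | ∃ ℓ u, Φ.mul ℓ u = algebraMap R B s}
  have htop : Ideal.span S = ⊤ := by
    by_contra hne
    obtain ⟨m, hm, hle⟩ := Ideal.exists_le_maximal _ hne
    obtain ⟨s, hs, ℓ, u, h, -⟩ := Φ.exists_local m hm
    exact hs (hle (Ideal.subset_span ⟨ℓ, u, h⟩))
  obtain ⟨k, r, s, hrs⟩ := Submodule.mem_span_set'.1 ((Ideal.eq_top_iff_one _).1 htop)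
  choose ℓ u hu using fun i => (s i).2
  refine ⟨k, LinearMap.pi fun i => Φ.mul (ℓ i),
    ∑ i, r i • ((LinearMap.toSpanSingleton B N (u i)).restrictScalars R ∘ₗ LinearMap.proj i), ?_⟩
  ext v
  simp only [LinearMap.comp_apply, LinearMap.sum_apply, LinearMap.smul_apply, LinearMap.proj_apply,
    LinearMap.pi_apply, LinearMap.restrictScalars_apply, LinearMap.toSpanSingleton_apply,
    LinearMap.id_apply]
  simp_rw [fun i => Φ.mul_comm (ℓ i) v (u i), hu, algebraMap_smul, smul_smul, ← Finset.sum_smul]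
  simpa using congr($hrs • v)

include Φ in
lemma finite [Module.Finite R B] : Module.Finite R N := by
  obtain ⟨k, a, b, hab⟩ := Φ.exists_retraction
  exact Module.Finite.of_surjective b fun v => ⟨a v, congr($hab v)⟩

include Φ in
lemma projective [Module.Projective R B] : Module.Projective R N := by
  obtain ⟨k, a, b, hab⟩ := Φ.exists_retraction
  have : Module.Projective R (Fin k → B) := .of_equiv (DFinsupp.linearEquivFunOnFintype (R := R))
  exact Module.Projective.of_split a b hab

include Φ in
lemma rankAtStalk_eq (m : Ideal R) (hm : m.IsMaximal) :
    Module.rankAtStalk N ⟨m, hm.isPrime⟩ = Module.rankAtStalk B ⟨m, hm.isPrime⟩ := by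
  have := hm.isPrime
  obtain ⟨s, hs, ℓ, u, hu, -⟩ := Φ.exists_local m hm
  refine rankAtStalk_eq_of_comp_eq_smul m hs (Φ.mul ℓ)
    ((LinearMap.toSpanSingleton B N u).restrictScalars R) (fun v => ?_) fun b => ?_
  · simp [Φ.mul_comm ℓ v u, hu]
  · simp [Φ.mul_smul, hu, Algebra.smul_def, _root_.mul_comm]

variable {D : Type*} [AddCommGroup D] [Module R D] {n : ℕ} (ω : B [⋀^Fin (n + 1)]→ₗ[R] D)

/-- The alternating map `v ↦ b ∧ ℓ v₁ ∧ ⋯ ∧ ℓ vₙ`. -/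
def minor (b : B) (ℓ : Sym 1) : N [⋀^Fin n]→ₗ[R] D := (ω.curryLeft b).compLinearMap (Φ.mul ℓ)

/-- The alternating map `v ↦ ℓ v₀ ∧ ⋯ ∧ ℓ vₙ`. -/
def top (ℓ : Sym 1) : N [⋀^Fin (n + 1)]→ₗ[R] D := ω.compLinearMap (Φ.mul ℓ)

/-- This is how a minor with first entry other than `1` arises: as a contraction of a top form. -/
lemma top_curryLeft (ℓ : Sym 1) (w : N) :
    (Φ.top ω ℓ).curryLeft w = Φ.minor ω (Φ.mul ℓ w) ℓ := by
  rw [top, AlternatingMap.curryLeft_compLinearMap, minor]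

lemma minor_add (b b' : B) (ℓ : Sym 1) :
    Φ.minor ω (b + b') ℓ = Φ.minor ω b ℓ + Φ.minor ω b' ℓ := by
  simp [minor]

lemma minor_smul (r : R) (b : B) (ℓ : Sym 1) :
    Φ.minor ω (r • b) ℓ = r • Φ.minor ω b ℓ := by
  rw [minor, map_smul]
  rfl

/-- Locally, all alternating maps in `n + 1` variables are multiples of the map `Φ.top ω ℓ`, if `ℓ`
is invertible. -/
lemma exists_smul_eq_smul_top (hω : Submodule.span R (Set.range ω) = ⊤) (m : Ideal R)
    [hm : m.IsPrime] {q : R} (hq : q ∉ m) (c : Fin (n + 1) → N)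
    (hc : ∀ v, q • v ∈ Submodule.span R (Set.range c)) {s : R} (hs : s ∉ m) {ℓ : Sym 1} {u : N}
    (hu : Φ.mul ℓ u = algebraMap R B s) (h : N [⋀^Fin (n + 1)]→ₗ[R] D) :
    ∃ r ∉ m, ∃ a : R, r • h = a • Φ.top ω ℓ := by
  have hpow : ∀ {x : R}, x ∉ m → x ^ (n + 1) ∉ m := fun hx h => hx (hm.mem_of_pow_mem _ h)
  have hdet : ∀ v : Fin (n + 1) → N, ∃ a : R, ∀ g : N [⋀^Fin (n + 1)]→ₗ[R] D,
      q ^ (n + 1) • g v = a • g c := fun v => by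
    have hv := fun i => hc (v i)
    simp_rw [Submodule.mem_span_range_iff_exists_fun] at hv
    choose A hA using hv
    refine ⟨(Matrix.of A).det, fun g => ?_⟩
    have := g.map_smul_univ (fun _ => q) v
    rw [Finset.prod_const, Finset.card_univ, Fintype.card_fin] at this
    rw [← alternatingMap_apply_sum_smul, ← this]
    simp [hA]
  -- `D` is spanned by the values of `ω`, and `s ^ (n + 1) • ω b` is the value of `Φ.top ω ℓ` at the
  -- vectors `bᵢ • u`. Hence `Φ.top ω ℓ c` generates `D` locally.
  have hD : ∀ d : D, ∃ a : R, (q ^ (n + 1) * s ^ (n + 1)) • d = a • Φ.top ω ℓ c := fun d => by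
    have hd : d ∈ Submodule.span R (Set.range ω) := hω ▸ Submodule.mem_top
    induction hd using Submodule.span_induction with
    | mem d hd =>
      obtain ⟨b, rfl⟩ := hd
      obtain ⟨a, ha⟩ := hdet fun i => b i • u
      refine ⟨a, ?_⟩
      rw [← ha, SemigroupAction.mul_smul]
      congr 1
      have := ω.map_smul_univ (fun _ => s) b
      simp only [Finset.prod_const, Finset.card_univ, Fintype.card_fin] at this
      rw [← this, top, AlternatingMap.compLinearMap_apply]
      congr 1
      funext i
      rw [Φ.mul_smul, hu, Algebra.smul_def, _root_.mul_comm]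
    | zero => exact ⟨0, by simp⟩
    | add x y _ _ hx hy =>
      obtain ⟨a, ha⟩ := hx
      obtain ⟨a', ha'⟩ := hy
      exact ⟨a + a', by rw [smul_add, ha, ha', add_smul]⟩
    | smul r x _ hx =>
      obtain ⟨a, ha⟩ := hx
      exact ⟨r * a, by rw [smul_comm, ha, SemigroupAction.mul_smul]⟩
  obtain ⟨a, ha⟩ := hD (h c)
  -- One factor `q ^ (n + 1)` reduces a general `v` to `c`; the remaining scalar expresses `h c`
  -- through `Φ.top ω ℓ c`.
  refine ⟨q ^ (n + 1) * s ^ (n + 1) * q ^ (n + 1),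
    hm.mul_notMem (hm.mul_notMem (hpow hq) (hpow hs)) (hpow hq), a * q ^ (n + 1), ?_⟩
  ext v
  obtain ⟨a', ha'⟩ := hdet v
  rw [AlternatingMap.smul_apply, AlternatingMap.smul_apply, SemigroupAction.mul_smul, ha', smul_comm,
    ha, SemigroupAction.mul_smul, ha', smul_comm]

variable [Module ℂ D] [IsScalarTower ℂ R D]

/-- The witness is the alternatization of `v ↦ b ∧ ℓ₁ v₁ ∧ ⋯ ∧ ℓₙ vₙ` divided by `n!`. On the
diagonal this map is already alternating, so alternatization only multiplies it by `n!`. -/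
lemma exists_multilinear_minor (b : B) :
    ∃ G : MultilinearMap ℂ (fun _ : Fin n => Sym 1) (N [⋀^Fin n]→ₗ[R] D),
      ∀ ℓ, (G fun _ => ℓ) = Φ.minor ω b ℓ := by
  let g : (Fin n → Sym 1) → MultilinearMap R (fun _ : Fin n => N) D := fun ℓ =>
    (ω.curryLeft b).toMultilinearMap.compLinearMap fun i => Φ.mul (ℓ i)
  have hg : ∀ [DecidableEq (Fin n)] (ℓ : Fin n → Sym 1) i x (v : Fin n → N),
      g (Function.update ℓ i x) v =
        ω.curryLeft b (Function.update (fun j => Φ.mul (ℓ j) (v j)) i (Φ.mul x (v i))) := by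
    intro _ ℓ i x v
    simp only [g, MultilinearMap.compLinearMap_apply, AlternatingMap.coe_multilinearMap]
    congr 1
    funext j
    by_cases hj : j = i
    · subst hj; simp
    · simp [hj]
  refine ⟨⟨fun ℓ => (n.factorial : ℂ)⁻¹ • MultilinearMap.alternatization (g ℓ), ?_, ?_⟩, fun ℓ => ?_⟩
  · intro _ ℓ i x y
    have : g (Function.update ℓ i (x + y)) = g (Function.update ℓ i x) + g (Function.update ℓ i y) := by
      ext v
      rw [add_apply, hg, hg, hg, Φ.mul_add_left, LinearMap.add_apply,
        AlternatingMap.map_update_add]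
    rw [this, map_add, smul_add]
  · intro _ ℓ i r x
    have : g (Function.update ℓ i (r • x)) = algebraMap ℂ R r • g (Function.update ℓ i x) := by
      ext v
      rw [smul_apply, hg, hg, Φ.mul_smul_left, LinearMap.smul_apply,
        AlternatingMap.map_update_smul]
    rw [this, smul_comm r]
    congr 1
    ext v
    simp only [MultilinearMap.alternatization_apply, AlternatingMap.smul_apply, Finset.smul_sum,
      MultilinearMap.domDomCongr_apply, smul_apply, algebraMap_smul]
    exact Finset.sum_congr rfl fun σ _ => smul_comm _ _ _
  · have : g (fun _ => ℓ) = (Φ.minor ω b ℓ).toMultilinearMap := rfl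
    simp only [MultilinearMap.coe_mk, this]
    have h2 := AlternatingMap.coe_alternatization (Φ.minor ω b ℓ)
    rw [h2, Fintype.card_fin, ← Nat.cast_smul_eq_nsmul ℂ, smul_smul, inv_mul_cancel₀, one_smul]
    exact_mod_cast n.factorial_ne_zero

/-- The maximal minors define a linear map on `S_n V`. -/
lemma exists_minorMap : ∃ p : R ⊗[ℂ] Sym n →ₗ[R] N [⋀^Fin n]→ₗ[R] D,
    ∀ ℓ, p (1 ⊗ₜ powForm n ℓ) = Φ.minor ω 1 ℓ := by
  obtain ⟨G, hG⟩ := Φ.exists_multilinear_minor ω 1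
  obtain ⟨p, hp⟩ := exists_linearMap_powForm G
  have : IsScalarTower ℂ R (N [⋀^Fin n]→ₗ[R] D) := ⟨fun a b f => by ext; simp⟩
  exact ⟨p.liftBaseChange R, fun ℓ => by simp [hp, hG]⟩

section Local

variable {Φ ω} {m : Ideal R} [hm : m.IsPrime] {s : R} {ℓ₀ : Sym 1} {u : N}

/-- Let `ξ = ℓ u` and `ℓ_t = ℓ₀ + t ℓ`. Contracting the top form of `ℓ_t` with `ξ ^ k u` gives `s`
times the minor of `ξ ^ k` plus `t` times that of `ξ ^ (k + 1)`, both at `ℓ_t`. This top form is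
locally a multiple of the one of `ℓ₀`, whose contraction is a multiple of the minor of `ξ ^ k` at
`ℓ₀`. Induction therefore needs all `t` at once, including `t = 0`. -/
lemma minor_pow_mem_saturation (hu : Φ.mul ℓ₀ u = algebraMap R B s)
    (htop : ∀ h : N [⋀^Fin (n + 1)]→ₗ[R] D, ∃ r ∉ m, ∃ a : R, r • h = a • Φ.top ω ℓ₀)
    {W : Submodule R (N [⋀^Fin n]→ₗ[R] D)} (hW : ∀ ℓ, Φ.minor ω 1 ℓ ∈ W) (ℓ : Sym 1) (k : ℕ) :
    ∀ t : ℂ, Φ.minor ω (Φ.mul ℓ u ^ k) (ℓ₀ + t • ℓ) ∈ saturation m W := by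
  set ξ := Φ.mul ℓ u with hξ
  induction k with
  | zero => exact fun t => le_saturation m W (by simpa using hW _)
  | succ k ih =>
    have hne : ∀ t : ℂ, t ≠ 0 → Φ.minor ω (ξ ^ (k + 1)) (ℓ₀ + t • ℓ) ∈ saturation m W := by
      intro t ht
      have h1 : (Φ.top ω (ℓ₀ + t • ℓ)).curryLeft (ξ ^ k • u) =
          s • Φ.minor ω (ξ ^ k) (ℓ₀ + t • ℓ) +
            algebraMap ℂ R t • Φ.minor ω (ξ ^ (k + 1)) (ℓ₀ + t • ℓ) := by
        rw [top_curryLeft, ← minor_smul, ← minor_smul, ← minor_add]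
        congr 1
        rw [Φ.mul_smul, Φ.mul_add_left, Φ.mul_smul_left, LinearMap.add_apply, hu,
          LinearMap.smul_apply, ← hξ, Algebra.smul_def, Algebra.smul_def, Algebra.smul_def]
        ring
      have h2 : (Φ.top ω (ℓ₀ + t • ℓ)).curryLeft (ξ ^ k • u) ∈ saturation m W := by
        obtain ⟨r, hr, a, ha⟩ := htop (Φ.top ω (ℓ₀ + t • ℓ))
        refine mem_saturation_of_smul_mem hr ?_
        have h3 := congr(($ha).curryLeft (ξ ^ k • u))
        rw [AlternatingMap.curryLeft_smul, AlternatingMap.curryLeft_smul, LinearMap.smul_apply,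
          LinearMap.smul_apply, top_curryLeft _ _ ℓ₀, Φ.mul_smul, hu, _root_.mul_comm,
          ← Algebra.smul_def, minor_smul] at h3
        rw [h3]
        exact Submodule.smul_mem _ _ (Submodule.smul_mem _ _ (by simpa using ih 0))
      rw [h1] at h2
      have h4 := (Submodule.add_mem_iff_right _ (Submodule.smul_mem _ s (ih t))).1 h2
      have h5 := Submodule.smul_mem _ (algebraMap ℂ R t⁻¹) h4
      rwa [smul_smul, ← map_mul, inv_mul_cancel₀ ht, map_one, one_smul] at h5
    intro t
    by_cases ht : t = 0
    -- Nothing can be divided by `t = 0`, but the minor is a polynomial in `t` whose values at `t ≠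
    -- 0` are in the subspace; so is its constant coefficient.
    · obtain ⟨G, hG⟩ := Φ.exists_multilinear_minor ω (ξ ^ (k + 1))
      obtain ⟨z, hz⟩ := exists_multilinear_add_smul G ℓ₀ ℓ
      have : IsScalarTower ℂ R (N [⋀^Fin n]→ₗ[R] D) := ⟨fun a b f => by ext; simp⟩
      have h0 := coeff_mem_of_forall_sum_pow_smul_mem ((saturation m W).restrictScalars ℂ) (n + 1) z
        (fun t ht => by rw [← hz, hG]; exact hne t ht) (j := 0) (by lia)
      have hz0 := hz 0
      rw [hG, Finset.sum_eq_single 0 (fun j _ hj => by simp [hj]) (by simp)] at hz0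
      rw [ht, hz0]
      simpa using h0
    · exact hne t ht

/-- At `t = 0` the previous lemma gives all powers of linear combinations of the `xᵢ u`.
Polarization gives all monomials, and these span the adjoined algebra, which is locally all of `B`.
-/
lemma minor_mem_saturation (hu : Φ.mul ℓ₀ u = algebraMap R B s)
    (hadj : ∀ b : B, ∃ r ∉ m, r • b ∈ Algebra.adjoin R (Set.range fun ℓ' => Φ.mul ℓ' u))
    (htop : ∀ h : N [⋀^Fin (n + 1)]→ₗ[R] D, ∃ r ∉ m, ∃ a : R, r • h = a • Φ.top ω ℓ₀)
    {W : Submodule R (N [⋀^Fin n]→ₗ[R] D)} (hW : ∀ ℓ, Φ.minor ω 1 ℓ ∈ W) (b : B) :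
    Φ.minor ω b ℓ₀ ∈ saturation m W := by
  let ψ : B →ₗ[R] N [⋀^Fin n]→ₗ[R] D :=
    { toFun := fun b => Φ.minor ω b ℓ₀
      map_add' := fun b b' => Φ.minor_add ω b b' ℓ₀
      map_smul' := fun r b => Φ.minor_smul ω r b ℓ₀ }
  let P : Submodule R B := (saturation m W).comap ψ
  let _ : Algebra ℂ B := ((algebraMap R B).comp (algebraMap ℂ R)).toAlgebra
  have : IsScalarTower ℂ R B := .of_algebraMap_eq fun _ => rfl
  let x : Fin 3 → B := fun i => Φ.mul (coord i) u
  have hx : ∀ a : Fin 3 → ℂ, Φ.mul (linForm a) u = a 0 • x 0 + a 1 • x 1 + a 2 • x 2 := fun a => by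
    simp only [linForm, Fin.sum_univ_three, Φ.mul_add_left, Φ.mul_smul_left, LinearMap.add_apply,
      LinearMap.smul_apply, algebraMap_smul, x]
  have hmon : ∀ i j k, x 0 ^ i * x 1 ^ j * x 2 ^ k ∈ P := fun i j k =>
    monomial_mem_of_forall_pow_mem (P.restrictScalars ℂ) (m := i + j + k) (fun a b c => by
      have := minor_pow_mem_saturation hu htop hW (linForm ![a, b, c]) (i + j + k) 0
      rw [hx, zero_smul, add_zero] at this
      exact this) rfl
  have hle : Algebra.adjoin R (Set.range fun ℓ' => Φ.mul ℓ' u) ≤ (MvPolynomial.aeval x).range := by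
    refine Algebra.adjoin_le ?_
    rintro _ ⟨ℓ, rfl⟩
    obtain ⟨a, rfl⟩ := exists_eq_linForm ℓ
    refine ⟨∑ i, MvPolynomial.C (algebraMap ℂ R (a i)) * MvPolynomial.X i, ?_⟩
    simp [hx, Fin.sum_univ_three, ← Algebra.smul_def]
  have hP : ∀ q : MvPolynomial (Fin 3) R, MvPolynomial.aeval x q ∈ P := fun q => by
    rw [MvPolynomial.aeval_def, MvPolynomial.eval₂_eq']
    refine P.sum_mem fun α _ => ?_
    rw [← Algebra.smul_def, Fin.prod_univ_three]
    exact P.smul_mem _ (hmon _ _ _)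
  obtain ⟨r, hr, hrb⟩ := hadj b
  refine mem_saturation_of_smul_mem hr ?_
  rw [← minor_smul]
  obtain ⟨q, hq⟩ := hle hrb
  have := hP q
  rw [show MvPolynomial.aeval x q = r • b from hq] at this
  exact this

end Local

/-- Every `n`-form is `∑ ι_{e_j} (f_j ∧ g)`. Locally `f_j ∧ g` is a multiple of the top form of
`ℓ₀`, and contraction with `e_j` yields the minor with first entry `ℓ₀ e_j`. -/
lemma minor_span_eq_top [Module.Finite R B] [Module.Projective R B]
    (hrank : ∀ p, Module.rankAtStalk (R := R) B p = n + 1)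
    (hω : Submodule.span R (Set.range ω) = ⊤)
    {W : Submodule R (N [⋀^Fin n]→ₗ[R] D)} (hW : ∀ ℓ, Φ.minor ω 1 ℓ ∈ W) : W = ⊤ := by
  have := Φ.finite
  have := Φ.projective
  obtain ⟨k, e, f, hef⟩ := exists_dual_basis R N
  rw [eq_top_iff]
  rintro g -
  refine mem_of_forall_isMaximal W g fun m hm => ?_
  have := hm.isPrime
  obtain ⟨s, hs, ℓ₀, u, hu, hadj⟩ := Φ.exists_local m hm
  obtain ⟨q, hq, c, hc⟩ := exists_smul_mem_span_of_rankAtStalk (M := N) m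
    ((Φ.rankAtStalk_eq m hm).trans (hrank _))
  have htop := Φ.exists_smul_eq_smul_top ω hω m hq c hc hs hu
  have htr := sum_dual_basis hef (k := n + 1) fun m hm => (Φ.rankAtStalk_eq m hm).trans (hrank _)
  have hg := sum_formWedge_curryLeft hef g
  rw [htr, Nat.cast_smul_eq_nsmul, succ_nsmul, add_sub_cancel_left] at hg
  rw [← mem_saturation, ← hg]
  refine Submodule.sum_mem _ fun j _ => ?_
  obtain ⟨r, hr, a, ha⟩ := htop (formWedge (f j) g)
  refine mem_saturation_of_smul_mem hr ?_
  have := congr(($ha).curryLeft (e j))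
  rw [AlternatingMap.curryLeft_smul, AlternatingMap.curryLeft_smul, LinearMap.smul_apply,
    LinearMap.smul_apply, top_curryLeft _ _ ℓ₀] at this
  rw [this]
  exact Submodule.smul_mem _ _ (minor_mem_saturation hu hadj htop hW _)

/-- The minors of the pairings define a unique linear map from `S_n V`, which is surjective. -/
theorem existsUnique_and_surjective [Module.Finite R B] [Module.Projective R B]
    (hrank : ∀ p, Module.rankAtStalk (R := R) B p = n + 1) :
    (∃! p : R ⊗[ℂ] Sym n →ₗ[R] N ⊗[R] ((⋀[R]^(n + 1) B) ⊗[R] Module.Dual R (⋀[R]^(n + 1) N)),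
      ∀ ℓ, contraction R N (⋀[R]^(n + 1) B) n (p (1 ⊗ₜ powForm n ℓ)) =
        Φ.minor (exteriorPower.ιMulti R (n + 1)) 1 ℓ) ∧
    ∀ p : R ⊗[ℂ] Sym n →ₗ[R] N ⊗[R] ((⋀[R]^(n + 1) B) ⊗[R] Module.Dual R (⋀[R]^(n + 1) N)),
      (∀ ℓ, contraction R N (⋀[R]^(n + 1) B) n (p (1 ⊗ₜ powForm n ℓ)) =
        Φ.minor (exteriorPower.ιMulti R (n + 1)) 1 ℓ) → Function.Surjective p := by
  have := Φ.finite
  have := Φ.projective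
  let _ : Module ℂ (⋀[R]^(n + 1) B) := Module.compHom _ (algebraMap ℂ R)
  have : IsScalarTower ℂ R (⋀[R]^(n + 1) B) := ⟨fun a b x => by
    rw [Algebra.smul_def, SemigroupAction.mul_smul]; rfl⟩
  obtain ⟨k, e, f, hef⟩ := exists_dual_basis R N
  have hC : Function.Bijective (contraction R N (⋀[R]^(n + 1) B) n) :=
    contraction_bijective hef
      (sum_dual_basis hef fun m hm => (Φ.rankAtStalk_eq m hm).trans (hrank _)) fun h =>
        alternatingMap_eq_zero (fun m hm => by
          have := hm.isPrime
          exact exists_smul_mem_span_of_rankAtStalk m ((Φ.rankAtStalk_eq m hm).trans (hrank _))) h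
  let C := LinearEquiv.ofBijective _ hC
  obtain ⟨q, hq⟩ := Φ.exists_minorMap (exteriorPower.ιMulti R (n + 1))
  refine ⟨⟨C.symm.toLinearMap ∘ₗ q, fun ℓ => ?_, fun p hp => ?_⟩, fun p hp => ?_⟩
  · rw [LinearMap.comp_apply, hq]
    exact C.apply_symm_apply _
  · refine baseChange_sym_ext fun ℓ => C.injective ?_
    rw [LinearMap.comp_apply, hq]
    exact (hp ℓ).trans (C.apply_symm_apply _).symm
  -- The range is a submodule containing every minor, so the spanning result applies with it as `W`.
  · have h : (C.toLinearMap ∘ₗ p).range = ⊤ :=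
      Φ.minor_span_eq_top (exteriorPower.ιMulti R (n + 1)) hrank
        (exteriorPower.ιMulti_span R (n + 1) B) fun ℓ => ⟨_, hp ℓ⟩
    rw [LinearMap.range_eq_top, LinearMap.coe_comp] at h
    exact fun x => by
      obtain ⟨y, hy⟩ := h (C x)
      exact ⟨y, C.injective hy⟩

end LinearForms

/-! ### Inverses of linear forms on a punctual scheme -/

section Punctual

variable {I : Ideal (MvPolynomial (Fin 2) ℂ)}

lemma isNilpotent_linear (hI : I.radical = Ideal.span {MvPolynomial.X 0, MvPolynomial.X 1}) (a b : ℂ) :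
    IsNilpotent (a • Ideal.Quotient.mk I (MvPolynomial.X 0) +
      b • Ideal.Quotient.mk I (MvPolynomial.X 1)) := by
  have h : MvPolynomial.C a * MvPolynomial.X 0 + MvPolynomial.C b * MvPolynomial.X 1 ∈ I.radical := by
    rw [hI]
    exact Ideal.add_mem _ (Ideal.mul_mem_left _ _ (Ideal.subset_span (by simp)))
      (Ideal.mul_mem_left _ _ (Ideal.subset_span (by simp)))
  obtain ⟨k, hk⟩ := h
  refine ⟨k, ?_⟩
  rw [← Ideal.Quotient.eq_zero_iff_mem, map_pow, ← MvPolynomial.smul_eq_C_mul,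
    ← MvPolynomial.smul_eq_C_mul] at hk
  exact hk

lemma mk_one_sub_linear (a b : ℂ) :
    Ideal.Quotient.mk I (1 - MvPolynomial.C a * MvPolynomial.X 0 -
      MvPolynomial.C b * MvPolynomial.X 1) =
    1 - (a • Ideal.Quotient.mk I (MvPolynomial.X 0) + b • Ideal.Quotient.mk I (MvPolynomial.X 1)) := by
  rw [← MvPolynomial.smul_eq_C_mul, ← MvPolynomial.smul_eq_C_mul, sub_sub]
  rfl

lemma isUnit_one_sub_linear (hI : I.radical = Ideal.span {MvPolynomial.X 0, MvPolynomial.X 1})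
    (a b : ℂ) : IsUnit (Ideal.Quotient.mk I (1 - MvPolynomial.C a * MvPolynomial.X 0 -
      MvPolynomial.C b * MvPolynomial.X 1)) := by
  rw [mk_one_sub_linear]
  exact (isNilpotent_linear hI a b).isUnit_one_sub

/-- The inverse of `1 - t (a x + b y)` is a finite geometric series, a polynomial curve in `t` lying
in the span. Its coefficients `(a x + b y) ^ j` lie there too, and polarization gives all monomials.
-/
lemma span_inverses_eq_top (hI : I.radical = Ideal.span {MvPolynomial.X 0, MvPolynomial.X 1}) :
    Submodule.span ℂ {u : MvPolynomial (Fin 2) ℂ ⧸ I | ∃ a b : ℂ,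
      u * Ideal.Quotient.mk I (1 - MvPolynomial.C a * MvPolynomial.X 0 -
        MvPolynomial.C b * MvPolynomial.X 1) = 1} = ⊤ := by
  set W := Submodule.span ℂ {u : MvPolynomial (Fin 2) ℂ ⧸ I | ∃ a b : ℂ,
      u * Ideal.Quotient.mk I (1 - MvPolynomial.C a * MvPolynomial.X 0 -
        MvPolynomial.C b * MvPolynomial.X 1) = 1} with hW
  let x := Ideal.Quotient.mk I (MvPolynomial.X 0)
  let y := Ideal.Quotient.mk I (MvPolynomial.X 1)
  have hpow : ∀ (a b : ℂ) (j : ℕ), (a • x + b • y) ^ j ∈ W := fun a b j => by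
    obtain ⟨N, hN⟩ := isNilpotent_linear hI a b
    have hinv : ∀ t : ℂ, ∑ i ∈ Finset.range N, t ^ i • (a • x + b • y) ^ i ∈ W := fun t => by
      refine Submodule.subset_span ⟨t * a, t * b, ?_⟩
      have h1 : (t * a) • x + (t * b) • y = t • (a • x + b • y) := by
        rw [smul_add, smul_smul, smul_smul]
      rw [mk_one_sub_linear]
      change _ * (1 - ((t * a) • x + (t * b) • y)) = 1
      rw [h1]
      simp_rw [← smul_pow]
      rw [geom_sum_mul_neg, smul_pow, hN, smul_zero, sub_zero]
    by_cases hj : j < N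
    · exact coeff_mem_of_forall_sum_pow_smul_mem W N _ (fun t _ => hinv t) hj
    · rw [pow_eq_zero_of_le (not_lt.1 hj) hN]
      exact W.zero_mem
  rw [eq_top_iff]
  rintro u -
  obtain ⟨q, rfl⟩ := Ideal.Quotient.mk_surjective u
  rw [q.as_sum, map_sum]
  refine W.sum_mem fun α _ => ?_
  have h := monomial_mem_of_forall_pow_mem W (x := x) (y := y) (z := 0) (m := α 0 + α 1)
    (fun a b c => by simpa using hpow a b _) (i := α 0) (j := α 1) (k := 0) rfl
  have h2 := W.smul_mem (MvPolynomial.coeff α q) h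
  have h3 : MvPolynomial.monomial α (MvPolynomial.coeff α q) = MvPolynomial.coeff α q •
      (MvPolynomial.X 0 ^ α 0 * MvPolynomial.X 1 ^ α 1) := by
    rw [MvPolynomial.monomial_eq, Finsupp.prod_fintype _ _ (by simp), Fin.prod_univ_two,
      MvPolynomial.smul_eq_C_mul]
  rw [h3]
  change MvPolynomial.coeff α q • Ideal.Quotient.mk I _ ∈ W
  simpa [x, y] using h2

end Punctual

/-! ### Functions on the plane -/

/-- The function `ℓ / f` on the open set `f ≠ 0`, for linear forms `f` and `ℓ`. -/
def ratioAt (f ℓ : Sym 1) : Γ(Plane, Proj.basicOpen Sym (f : MvPolynomial (Fin 3) ℂ)) :=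
  Proj.awayToSection Sym (f : MvPolynomial (Fin 3) ℂ)
    (HomogeneousLocalization.mk ⟨1, ℓ, f, ⟨1, pow_one _⟩⟩)

lemma ratio_eq_ratioAt (i : Fin 3) (ℓ : Sym 1) : ratio i ℓ = ratioAt (coord i) ℓ := rfl

lemma ratioAt_mul_ratioAt {f g : Sym 1} {W : Plane.Opens}
    (hf : W ≤ Proj.basicOpen Sym (f : MvPolynomial (Fin 3) ℂ))
    (hg : W ≤ Proj.basicOpen Sym (g : MvPolynomial (Fin 3) ℂ)) (ℓ : Sym 1) :
    Plane.presheaf.map (homOfLE hg).op (ratioAt g ℓ) *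
      Plane.presheaf.map (homOfLE hf).op (ratioAt f g) =
      Plane.presheaf.map (homOfLE hf).op (ratioAt f ℓ) := by
  apply Subtype.ext
  ext x
  have : x.1.asHomogeneousIdeal.toIdeal.IsPrime := x.1.isPrime
  change (HomogeneousLocalization.mk _ * HomogeneousLocalization.mk _ :
      HomogeneousLocalization.AtPrime Sym x.1.asHomogeneousIdeal.toIdeal).val =
    (HomogeneousLocalization.mk _ : HomogeneousLocalization.AtPrime Sym x.1.asHomogeneousIdeal.toIdeal).val
  rw [HomogeneousLocalization.val_mul, HomogeneousLocalization.val_mk,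
    HomogeneousLocalization.val_mk, HomogeneousLocalization.val_mk, Localization.mk_mul,
    Localization.mk_eq_mk_iff, Localization.r_iff_exists]
  refine ⟨1, ?_⟩
  simp
  ring

lemma ratioAt_self (f : Sym 1) : ratioAt f f = 1 := by
  rw [ratioAt, ← map_one (Proj.awayToSection Sym (f : MvPolynomial (Fin 3) ℂ)).hom]
  congr 1
  apply HomogeneousLocalization.val_injective
  rw [HomogeneousLocalization.val_mk, HomogeneousLocalization.val_one]
  exact Localization.mk_self (⟨(f : MvPolynomial (Fin 3) ℂ), _⟩ : Submonoid.powers _)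

lemma isAffineOpen_basicOpen (f : Sym 1) :
    IsAffineOpen (Proj.basicOpen Sym (f : MvPolynomial (Fin 3) ℂ)) :=
  Proj.isAffineOpen_basicOpen Sym _ f.2 one_pos

lemma iSup_planeChart : ⨆ i, planeChart i = ⊤ := by
  refine Proj.iSup_basicOpen_eq_top' Sym _ (fun i => ⟨1, (coord i).2⟩) ?_
  rw [eq_top_iff]
  rintro q -
  induction q using MvPolynomial.induction_on with
  | C c => exact Subalgebra.algebraMap_mem _ (⟨MvPolynomial.C c, MvPolynomial.isHomogeneous_C _ _⟩ : Sym 0)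
  | add p q hp hq => exact add_mem hp hq
  | mul_X p i hp => exact mul_mem hp (Algebra.subset_adjoin ⟨i, rfl⟩)

/-- The functions on the open set `f ≠ 0` are generated by the ratios `ℓ / f`. -/
lemma mem_of_ratioAt_mem {f : Sym 1}
    (P : Subring Γ(Plane, Proj.basicOpen Sym (f : MvPolynomial (Fin 3) ℂ)))
    (hP : ∀ ℓ, ratioAt f ℓ ∈ P) (a : Γ(Plane, Proj.basicOpen Sym (f : MvPolynomial (Fin 3) ℂ))) :
    a ∈ P := by
  let φ : HomogeneousLocalization.Away Sym (f : MvPolynomial (Fin 3) ℂ) →+*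
    Γ(Plane, Proj.basicOpen Sym (f : MvPolynomial (Fin 3) ℂ)) :=
    (Proj.awayToSection Sym (f : MvPolynomial (Fin 3) ℂ)).hom
  have hφ : Function.Surjective φ := by
    have := (Proj.basicOpenIsoAway Sym (f : MvPolynomial (Fin 3) ℂ) f.2 one_pos).isIso_hom
    rw [Proj.basicOpenIsoAway_hom] at this
    exact (ConcreteCategory.bijective_of_isIso
      (Proj.awayToSection Sym (f : MvPolynomial (Fin 3) ℂ))).2
  obtain ⟨x, rfl⟩ := hφ a
  have hfr : ∀ ℓ : Sym 1, (HomogeneousLocalization.mk ⟨1, ℓ, f, ⟨1, pow_one _⟩⟩ :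
      HomogeneousLocalization.Away Sym (f : MvPolynomial (Fin 3) ℂ)) ∈ P.comap φ := hP
  -- Numerators are combinations of powers `ℓ ^ k`, and `ℓ ^ k / f ^ k = (ℓ / f) ^ k`.
  have key : ∀ (k : ℕ) (g : Sym k), (HomogeneousLocalization.mk ⟨k, g, powForm k f, ⟨k, rfl⟩⟩ :
      HomogeneousLocalization.Away Sym (f : MvPolynomial (Fin 3) ℂ)) ∈ P.comap φ := by
    intro k g
    have hg : g ∈ Submodule.span ℂ (Set.range (powForm k)) := span_powForm k ▸ Submodule.mem_top
    induction hg using Submodule.span_induction with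
    | mem g hg =>
      obtain ⟨ℓ, rfl⟩ := hg
      convert pow_mem (hfr ℓ) k using 1
      apply HomogeneousLocalization.val_injective
      rw [HomogeneousLocalization.val_pow, HomogeneousLocalization.val_mk,
        HomogeneousLocalization.val_mk, Localization.mk_pow]
      rfl
    | zero =>
      convert zero_mem (P.comap φ) using 1
      exact HomogeneousLocalization.mk_eq_zero_of_num _ rfl
    | add g g' _ _ hg hg' =>
      convert add_mem hg hg' using 1
      apply HomogeneousLocalization.val_injective
      rw [HomogeneousLocalization.val_add, HomogeneousLocalization.val_mk,
        HomogeneousLocalization.val_mk, HomogeneousLocalization.val_mk, Localization.add_mk_self]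
      rfl
    | smul c g _ hg =>
      -- `P` is only a subring; it contains the constant `c` as the ratio `(c f) / f`.
      convert mul_mem (hfr (c • f)) hg using 1
      apply HomogeneousLocalization.val_injective
      rw [HomogeneousLocalization.val_mul, HomogeneousLocalization.val_mk,
        HomogeneousLocalization.val_mk, HomogeneousLocalization.val_mk, Localization.mk_mul,
        Localization.mk_eq_mk_iff, Localization.r_iff_exists]
      refine ⟨1, ?_⟩
      simp only [OneMemClass.coe_one, one_mul, Submonoid.mk_mul_mk, Submodule.coe_smul,
        MvPolynomial.smul_eq_C_mul]
      ring
  obtain ⟨k, q, hq, rfl⟩ := HomogeneousLocalization.Away.mk_surjective Sym f.2 x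
  have := key k ⟨q, by simpa using hq⟩
  change _ ∈ P.comap φ
  convert this using 1
  apply HomogeneousLocalization.val_injective
  rw [HomogeneousLocalization.Away.val_mk, HomogeneousLocalization.val_mk]
  rfl

/-! ### Comparison of the two forms of the contraction -/

namespace Family

section Contract

variable {n : ℕ} {T : Scheme.{0}} {t : T ⟶ Spec (.of ℂ)} (F : Family (n + 1) t) (U : T.Opens)

lemma contract_eq_contraction (v : Fin n → F.E U (-1)) (z : F.EL U) :
    F.contract U v z =
      contraction (F.Base U) (F.E U (-1)) (⋀[F.Base U]^(n + 1) (F.E U 0)) n z v := by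
  have h : F.contract U v =
      ({ toFun := fun ω => ω v, map_add' := fun _ _ => rfl, map_smul' := fun _ _ => rfl } :
        (F.E U (-1) [⋀^Fin n]→ₗ[F.Base U] ⋀[F.Base U]^(n + 1) (F.E U 0)) →ₗ[F.Base U] _) ∘ₗ
      contraction (F.Base U) (F.E U (-1)) (⋀[F.Base U]^(n + 1) (F.E U 0)) n := by
    refine TensorProduct.ext (LinearMap.ext fun e => TensorProduct.ext' fun d θ => ?_)
    exact (F.contract_tmul U v e d θ).trans
      (tensorDualToAlternating_tmul d θ (Fin.cons e v)).symm
  exact congr($h z)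

lemma isMinorMap_iff (p : F.SV U →ₗ[F.Base U] F.EL U) :
    F.IsMinorMap U p ↔ ∀ ℓ, contraction (F.Base U) (F.E U (-1)) (⋀[F.Base U]^(n + 1) (F.E U 0)) n
      (p (1 ⊗ₜ powForm n ℓ)) = ((exteriorPower.ιMulti (F.Base U) (n + 1)).curryLeft
        (F.one U)).compLinearMap (F.mulForm U ℓ) := by
  constructor
  · intro h ℓ
    refine AlternatingMap.ext fun v => ?_
    exact (F.contract_eq_contraction U v _).symm.trans (h ℓ v)
  · intro h ℓ v
    exact (F.contract_eq_contraction U v _).trans (AlternatingMap.congr_fun (h ℓ) v)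

end Contract

end Family

/-- The universal property maps the pushout to `S`, and the composite with the inclusion of `S` is
the identity. -/
lemma mem_of_isPushout {A B C P : CommRingCat} {f : A ⟶ B} {g : A ⟶ C} {inl : B ⟶ P} {inr : C ⟶ P}
    (h : IsPushout f g inl inr) (S : Subring P) (hl : ∀ b, inl b ∈ S) (hr : ∀ c, inr c ∈ S) (p : P) :
    p ∈ S := by
  let l : B ⟶ CommRingCat.of S := CommRingCat.ofHom (inl.hom.codRestrict S hl)
  let r : C ⟶ CommRingCat.of S := CommRingCat.ofHom (inr.hom.codRestrict S hr)
  have hw : f ≫ l = g ≫ r := by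
    ext a
    exact congr($(h.w) a)
  let φ := h.desc l r hw
  have hφ : φ ≫ CommRingCat.ofHom S.subtype = 𝟙 P := by
    apply h.hom_ext
    · rw [h.inl_desc_assoc, Category.comp_id]; rfl
    · rw [h.inr_desc_assoc, Category.comp_id]; rfl
  rw [← show (φ ≫ CommRingCat.ofHom S.subtype) p = p by rw [hφ]; rfl]
  exact (φ p).2

/-! ### Functions on affine pieces of the family -/

namespace Family

section Charts

variable {r : ℕ} {T : Scheme.{0}} {t : T ⟶ Spec (.of ℂ)} (F : Family r t) {W : T.Opens}
  (f : Sym 1)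

/-- The part of `Z` above `W` where `f ≠ 0`. -/
def chartAt (W : T.Opens) (f : Sym 1) : F.Z.Opens :=
  F.toBase ⁻¹ᵁ W ⊓ F.toPlane ⁻¹ᵁ Proj.basicOpen Sym (f : MvPolynomial (Fin 3) ℂ)

/-- This part of `Z` is closed in the affine scheme `{f ≠ 0} × W`, whose ring is a pushout. So its
functions are generated by those from the base and from the plane. -/
lemma isAffineOpen_and_surjective (hW : IsAffineOpen W) : IsAffineOpen (F.chartAt W f) ∧
    ∀ S : Subring Γ(F.Z, F.chartAt W f),
      (∀ a, F.toBase.appLE W (F.chartAt W f) inf_le_left a ∈ S) →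
      (∀ a, F.toPlane.appLE _ (F.chartAt W f) inf_le_right a ∈ S) → S = ⊤ := by
  let i := pullback.lift F.toPlane F.toBase F.comm
  have : IsClosedImmersion i := F.isClosedImmersion
  have H := IsPullback.of_hasPullback planeStr t
  let D : Plane.Opens := Proj.basicOpen Sym (f : MvPolynomial (Fin 3) ℂ)
  have hD : IsAffineOpen D := isAffineOpen_basicOpen f
  let Y : (pullback planeStr t).Opens := pullback.fst planeStr t ⁻¹ᵁ D ⊓ pullback.snd planeStr t ⁻¹ᵁ W
  have hS : IsAffineOpen (⊤ : (Spec (.of ℂ)).Opens) := isAffineOpen_top _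
  have hY : IsAffineOpen Y := by
    have : IsAffine _ := hS
    have : IsAffine _ := hD
    have : IsAffine _ := hW
    exact .of_isIso (Scheme.Hom.isPullback_resLE H (US := ⊤) (UT := W) (UX := D) (UY := Y)
      le_top le_top rfl).isoPullback.hom
  have hiY : i ⁻¹ᵁ Y = F.chartAt W f := by
    have h1 : i ≫ pullback.fst planeStr t = F.toPlane := pullback.lift_fst ..
    have h2 : i ≫ pullback.snd planeStr t = F.toBase := pullback.lift_snd ..
    rw [chartAt, ← h1, ← h2, inf_comm]
    rfl
  refine ⟨hiY ▸ hY.preimage i, fun S hS1 hS2 => ?_⟩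
  have hpush := (isIso_pushoutSection_iff H (US := ⊤) (UT := W) (UX := D) (UY := Y)
    le_top le_top rfl).1 (isIso_pushoutSection_of_isAffineOpen H _ _ _ hS hW hD)
  have hle : F.chartAt W f ≤ i ⁻¹ᵁ Y := hiY.ge
  rw [eq_top_iff]
  rintro a -
  have hsurj : Function.Surjective (i.appLE Y (F.chartAt W f) hle) := by
    have h1 := i.app_surjective Y hY
    have : ∀ (V : F.Z.Opens) (hV : V = i ⁻¹ᵁ Y), Function.Surjective (i.appLE Y V hV.le) := by
      rintro _ rfl
      rwa [Scheme.Hom.appLE_eq_app]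
    exact this _ hiY.symm
  obtain ⟨b, rfl⟩ := hsurj a
  refine mem_of_isPushout hpush (S.comap (i.appLE Y (F.chartAt W f) hle).hom) (fun c => ?_)
    (fun c => ?_) b
  · have h1 : (pullback.fst planeStr t).appLE D Y inf_le_left ≫ i.appLE Y (F.chartAt W f) hle =
        F.toPlane.appLE D (F.chartAt W f) inf_le_right := by
      rw [Scheme.Hom.appLE_comp_appLE]
      congr 1
      exact pullback.lift_fst ..
    exact (congrArg (· ∈ S) (congr($h1 c))).mpr (hS2 c)
  · have h1 : (pullback.snd planeStr t).appLE W Y inf_le_right ≫ i.appLE Y (F.chartAt W f) hle =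
        F.toBase.appLE W (F.chartAt W f) inf_le_left := by
      rw [Scheme.Hom.appLE_comp_appLE]
      congr 1
      exact pullback.lift_snd ..
    exact (congrArg (· ∈ S) (congr($h1 c))).mpr (hS1 c)

end Charts

end Family

/-! ### Functions on `Z` as sections of `ℰ_0` -/

namespace Family

section Ring

variable {r : ℕ} {T : Scheme.{0}} {t : T ⟶ Spec (.of ℂ)} (F : Family r t) (U : T.Opens)

lemma mem_E_zero (f : (i : Fin 3) → F.ChartRing U i) :
    f ∈ F.E U 0 ↔ ∀ i j, F.resRight U i j (f j) = F.resLeft U i j (f i) := by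
  change (∀ i j, _ = _) ↔ _
  simp

lemma mem_E_neg_one (f : (i : Fin 3) → F.ChartRing U i) :
    f ∈ F.E U (-1) ↔ ∀ i j, F.resRight U i j (f j) =
      F.resLeft U i j (F.frac U i (coord j)) * F.resLeft U i j (f i) := by
  change (∀ i j, _ = _) ↔ _
  simp

/-- The ring structure on the sections of `ℰ_0`. -/
abbrev commRingE : CommRing (F.E U 0) :=
  { (inferInstance : AddCommGroup (F.E U 0)) with
    mul := fun a b => ⟨a.1 * b.1, by
      have ha := (F.mem_E_zero U _).1 a.2
      have hb := (F.mem_E_zero U _).1 b.2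
      rw [mem_E_zero]
      intro i j
      rw [Pi.mul_apply, Pi.mul_apply, map_mul, map_mul, ha, hb]⟩
    one := F.one U
    mul_assoc := fun a b c => Subtype.ext (mul_assoc a.1 b.1 c.1)
    mul_comm := fun a b => Subtype.ext (mul_comm a.1 b.1)
    one_mul := fun a => Subtype.ext (one_mul a.1)
    mul_one := fun a => Subtype.ext (mul_one a.1)
    left_distrib := fun a b c => Subtype.ext (mul_add a.1 b.1 c.1)
    right_distrib := fun a b c => Subtype.ext (add_mul a.1 b.1 c.1)
    zero_mul := fun a => Subtype.ext (zero_mul a.1)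
    mul_zero := fun a => Subtype.ext (mul_zero a.1) }

attribute [local instance] commRingE

/-- The sections of `ℰ_0` as an algebra over the base. -/
abbrev algebraE : Algebra (F.Base U) (F.E U 0) :=
  Algebra.ofModule (fun a x y => Subtype.ext (smul_mul_assoc a x.1 y.1))
    (fun a x y => Subtype.ext (mul_smul_comm a x.1 y.1))

attribute [local instance] algebraE

lemma coe_algebraMap (a : F.Base U) (i : Fin 3) :
    (algebraMap (F.Base U) (F.E U 0) a).1 i = algebraMap _ (F.ChartRing U i) a := by
  rw [Algebra.algebraMap_eq_smul_one, Algebra.algebraMap_eq_smul_one]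
  rfl

/-- The sections of `ℰ_{-1}` as a module over the sections of `ℰ_0`. -/
abbrev moduleE : Module (F.E U 0) (F.E U (-1)) where
  smul b v := ⟨b.1 * v.1, by
    have hb := (F.mem_E_zero U _).1 b.2
    have hv := (F.mem_E_neg_one U _).1 v.2
    rw [mem_E_neg_one]
    intro i j
    rw [Pi.mul_apply, Pi.mul_apply, map_mul, map_mul, hb, hv]
    ring⟩
  one_smul v := Subtype.ext (one_mul v.1)
  mul_smul a b v := Subtype.ext (mul_assoc a.1 b.1 v.1)
  smul_zero a := Subtype.ext (mul_zero a.1)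
  smul_add a v w := Subtype.ext (mul_add a.1 v.1 w.1)
  add_smul a b v := Subtype.ext (add_mul a.1 b.1 v.1)
  zero_smul v := Subtype.ext (zero_mul v.1)

attribute [local instance] moduleE

lemma isScalarTowerE : IsScalarTower (F.Base U) (F.E U 0) (F.E U (-1)) :=
  ⟨fun a b v => Subtype.ext (smul_mul_assoc a b.1 v.1)⟩

attribute [local instance] isScalarTowerE

/-- The ring of functions on the part of `Z` above `U`. -/
def Total : Type := Γ(F.Z, F.toBase ⁻¹ᵁ U)

instance : CommRing (F.Total U) := inferInstanceAs (CommRing Γ(F.Z, F.toBase ⁻¹ᵁ U))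

instance : Algebra (F.Base U) (F.Total U) := (F.toBase.app U).hom.toAlgebra

/-- The restriction of functions to the part where `xᵢ ≠ 0`. -/
def toChart (i : Fin 3) : F.Total U →+* F.ChartRing U i :=
  (F.Z.presheaf.map (homOfLE (inf_le_left : F.chart U i ≤ F.toBase ⁻¹ᵁ U)).op).hom

lemma iSup_chart : F.toBase ⁻¹ᵁ U = ⨆ i, F.chart U i := by
  have h : ⨆ i, F.toPlane ⁻¹ᵁ planeChart i = ⊤ := by
    rw [← Scheme.Hom.preimage_iSup, iSup_planeChart]; rfl
  simp only [chart]
  rw [← inf_iSup_eq, h, inf_top_eq]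

/-- A function above `U` as a section of `ℰ_0`. -/
def totalToE : F.Total U →ₐ[F.Base U] F.E U 0 where
  toFun b := ⟨fun i => F.toChart U i b, by
    rw [mem_E_zero]
    intro i j
    exact congr($((F.Z.presheaf.map_comp (homOfLE (inf_le_left : F.chart U j ≤ F.toBase ⁻¹ᵁ U)).op
      (homOfLE (inf_le_right : F.chart U i ⊓ F.chart U j ≤ F.chart U j)).op).symm.trans
      (F.Z.presheaf.map_comp (homOfLE (inf_le_left : F.chart U i ≤ F.toBase ⁻¹ᵁ U)).op
      (homOfLE (inf_le_left : F.chart U i ⊓ F.chart U j ≤ F.chart U i)).op)) b)⟩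
  map_one' := Subtype.ext (funext fun i => map_one _)
  map_zero' := Subtype.ext (funext fun i => map_zero _)
  map_add' a b := Subtype.ext (funext fun i => map_add _ a b)
  map_mul' a b := Subtype.ext (funext fun i => map_mul _ a b)
  commutes' a := Subtype.ext (funext fun i => (F.coe_algebraMap U a i).symm)

/-- The three charts cover `Z` above `U`, so this is the sheaf condition. It transfers finiteness,
projectivity and rank to `ℰ_0`. -/
lemma totalToE_bijective : Function.Bijective (F.totalToE U) := by
  have key : ∀ f : F.E U 0, ∃! b : F.Total U, ∀ i, F.toChart U i b = f.1 i := fun f => by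
    refine F.Z.sheaf.existsUnique_gluing' (F.chart U) (F.toBase ⁻¹ᵁ U)
      (fun i => homOfLE inf_le_left) (F.iSup_chart U).le f.1 fun i j => ?_
    exact ((F.mem_E_zero U _).1 f.2 i j).symm
  constructor
  · intro a b hab
    obtain ⟨c, -, hc⟩ := key (F.totalToE U a)
    rw [hc a fun i => rfl, hc b fun i => by rw [hab]; rfl]
  · intro f
    obtain ⟨b, hb, -⟩ := key f
    exact ⟨b, Subtype.ext (funext hb)⟩

/-- Functions above `U` are the sections of `ℰ_0`. -/
def totalEquiv : F.Total U ≃ₐ[F.Base U] F.E U 0 :=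
  AlgEquiv.ofBijective (F.totalToE U) (F.totalToE_bijective U)

variable {U}

lemma finite_total (hU : IsAffineOpen U) : Module.Finite (F.Base U) (F.Total U) := by
  have := F.isFinite
  exact F.toBase.finite_app U hU

lemma isAffineOpen_total (hU : IsAffineOpen U) : IsAffineOpen (F.toBase ⁻¹ᵁ U) := by
  have := F.isFinite
  exact hU.preimage F.toBase

lemma flat_total (hU : IsAffineOpen U) : Module.Flat (F.Base U) (F.Total U) := by
  have := F.flat
  have h := F.toBase.flat_appLE hU (F.isAffineOpen_total hU) le_rfl
  rw [Scheme.Hom.appLE_eq_app] at h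
  exact h

lemma projective_total (hU : IsAffineOpen U) : Module.Projective (F.Base U) (F.Total U) := by
  have := F.finite_total hU
  have := F.flat_total hU
  have := F.locallyOfFinitePresentation
  have h := F.toBase.finitePresentation_appLE hU (F.isAffineOpen_total hU) le_rfl
  rw [Scheme.Hom.appLE_eq_app] at h
  have : Algebra.FinitePresentation (F.Base U) (F.Total U) := h
  have := Module.FinitePresentation.of_finite_of_finitePresentation (R := F.Base U) (S := F.Total U)
  exact Module.Flat.projective_of_finitePresentation

/-- The rank of a finite flat morphism is stable under base change, here along `Spec Γ(T, U) ⟶ T`.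
-/
lemma rankAtStalk_total (hU : IsAffineOpen U) (p : PrimeSpectrum (F.Base U)) :
    Module.rankAtStalk (F.Total U) p = r := by
  have := F.isFinite
  have := F.flat
  have := F.finite_total hU
  have := F.flat_total hU
  have hV := F.isAffineOpen_total hU
  rw [← Scheme.Hom.finrank_SpecMap_algebraMap]
  have hsq : IsPullback hV.fromSpec (Spec.map (F.toBase.app U)) F.toBase hU.fromSpec := by
    refine (IsOpenImmersion.isPullback _ _ _ _ ?_ ?_).flip
    · rw [← hU.SpecMap_appLE_fromSpec F.toBase hV le_rfl, Scheme.Hom.appLE_eq_app]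
    · rw [hV.opensRange_fromSpec, hU.opensRange_fromSpec]
  exact (Scheme.Hom.finrank_of_isPullback _ _ _ _ hsq p).trans (F.finrank_eq _)

lemma finite_E (hU : IsAffineOpen U) : Module.Finite (F.Base U) (F.E U 0) :=
  have := F.finite_total hU
  Module.Finite.equiv (F.totalEquiv U).toLinearEquiv

lemma projective_E (hU : IsAffineOpen U) : Module.Projective (F.Base U) (F.E U 0) :=
  have := F.projective_total hU
  Module.Projective.of_equiv (F.totalEquiv U).toLinearEquiv

lemma rankAtStalk_E (hU : IsAffineOpen U) (p : PrimeSpectrum (F.Base U)) :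
    Module.rankAtStalk (F.E U 0) p = r := by
  rw [← Module.rankAtStalk_eq_of_equiv (F.totalEquiv U).toLinearEquiv, F.rankAtStalk_total hU]

end Ring

end Family

/-! ### Constants and linearity of the ratios -/

lemma ΓSpecIso_inv_appLE {R : CommRingCat.{0}} {X : Scheme.{0}} {D : X.Opens} (g : X ⟶ Spec R)
    (φ : R ⟶ Γ(X, D)) (h : D.ι ≫ g = D.toSpecΓ ≫ Spec.map φ) :
    (Scheme.ΓSpecIso R).inv ≫ g.appLE ⊤ D le_top = φ := by
  have h1 : (Scheme.ΓSpecIso R).inv ≫ (D.ι ≫ g).appTop ≫ D.topIso.hom =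
      (Scheme.ΓSpecIso R).inv ≫ (D.toSpecΓ ≫ Spec.map φ).appTop ≫ D.topIso.hom := by rw [h]
  rw [Scheme.Hom.comp_appTop, Scheme.Hom.comp_appTop, Scheme.Opens.toSpecΓ_appTop,
    Category.assoc, Category.assoc, Category.assoc, ← Scheme.ΓSpecIso_inv_naturality_assoc] at h1
  simp only [Iso.inv_hom_id, Category.comp_id] at h1
  rw [← h1]
  congr 1
  simp only [Scheme.Hom.appLE, Scheme.Hom.appTop, Scheme.Opens.ι_app, Scheme.Opens.topIso_hom]
  exact congrArg (g.app ⊤ ≫ ·) (X.presheaf.map_comp _ _)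

/-- The constant functions on the open set `f ≠ 0`. -/
def constAt (f : Sym 1) : ℂ →+* Γ(Plane, Proj.basicOpen Sym (f : MvPolynomial (Fin 3) ℂ)) :=
  (Proj.awayToSection Sym (f : MvPolynomial (Fin 3) ℂ)).hom.comp
    ((HomogeneousLocalization.fromZeroRingHom Sym
      (Submonoid.powers (f : MvPolynomial (Fin 3) ℂ))).comp (algebraMap ℂ (Sym 0)))

lemma planeStr_appLE (f : Sym 1) (c : ℂ) :
    planeStr.appLE ⊤ (Proj.basicOpen Sym (f : MvPolynomial (Fin 3) ℂ)) le_top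
      ((Scheme.ΓSpecIso (.of ℂ)).inv c) = constAt f c := by
  refine congr($(ΓSpecIso_inv_appLE (R := .of ℂ) planeStr (CommRingCat.ofHom ((algebraMap ℂ (Sym 0))) ≫
    CommRingCat.ofHom (HomogeneousLocalization.fromZeroRingHom Sym
      (Submonoid.powers (f : MvPolynomial (Fin 3) ℂ))) ≫ Proj.awayToSection Sym (f : MvPolynomial (Fin 3) ℂ)) ?_) c)
  have h := Proj.awayι_toSpecZero Sym (f : MvPolynomial (Fin 3) ℂ) f.2 one_pos
  rw [Proj.awayι, Category.assoc, Iso.inv_comp_eq, Proj.basicOpenIsoSpec_hom,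
    Proj.basicOpenToSpec, Category.assoc, ← Spec.map_comp] at h
  rw [planeStr, reassoc_of% h, ← Spec.map_comp]

lemma ratioAt_smul (f ℓ : Sym 1) (c : ℂ) : ratioAt f (c • ℓ) = constAt f c * ratioAt f ℓ := by
  rw [ratioAt, ratioAt, constAt, RingHom.comp_apply]
  refine Eq.trans ?_ (map_mul (Proj.awayToSection Sym (f : MvPolynomial (Fin 3) ℂ)).hom _ _)
  congr 1
  apply HomogeneousLocalization.val_injective
  rw [HomogeneousLocalization.val_mul]
  change Localization.mk _ _ = Localization.mk _ _ * Localization.mk _ _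
  rw [Localization.mk_mul, Localization.mk_eq_mk_iff, Localization.r_iff_exists]
  refine ⟨1, ?_⟩
  simp [MvPolynomial.smul_eq_C_mul, MvPolynomial.algebraMap_eq]

lemma ratioAt_add (f ℓ ℓ' : Sym 1) : ratioAt f (ℓ + ℓ') = ratioAt f ℓ + ratioAt f ℓ' := by
  rw [ratioAt, ratioAt, ratioAt]
  refine Eq.trans ?_ (map_add (Proj.awayToSection Sym (f : MvPolynomial (Fin 3) ℂ)).hom _ _)
  congr 1
  apply HomogeneousLocalization.val_injective
  rw [HomogeneousLocalization.val_add, HomogeneousLocalization.val_mk,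
    HomogeneousLocalization.val_mk, HomogeneousLocalization.val_mk, Localization.add_mk_self]
  rfl

/-! ### Linearity over the family and lines missing a fibre -/

namespace Family

variable {r : ℕ} {T : Scheme.{0}} {t : T ⟶ Spec (.of ℂ)} (F : Family r t) (U : T.Opens)

lemma frac_add (i : Fin 3) (ℓ ℓ' : Sym 1) :
    F.frac U i (ℓ + ℓ') = F.frac U i ℓ + F.frac U i ℓ' := by
  rw [frac, frac, frac, ratio_eq_ratioAt, ratioAt_add]
  exact map_add (F.toPlane.appLE (planeChart i) (F.chart U i) inf_le_right).hom _ _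

/-- Constants reach `Z` through the plane and through the base; `F.comm` says that the two agree. -/
lemma frac_smul (i : Fin 3) (c : ℂ) (ℓ : Sym 1) :
    F.frac U i (c • ℓ) = algebraMap (F.Base U) _ (algebraMap ℂ (F.Base U) c) * F.frac U i ℓ := by
  rw [frac, frac, ratio_eq_ratioAt, ratioAt_smul, ← planeStr_appLE]
  refine (map_mul (F.toPlane.appLE (planeChart i) (F.chart U i) inf_le_right).hom _ _).trans ?_
  congr 1
  have h1 := F.toPlane.appLE_comp_appLE planeStr ⊤ (planeChart i) (F.chart U i) le_top inf_le_right
  have h2 := F.toBase.appLE_comp_appLE t ⊤ U (F.chart U i) le_top inf_le_left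
  have h3 : (F.toPlane ≫ planeStr).appLE ⊤ (F.chart U i) le_top =
    (F.toBase ≫ t).appLE ⊤ (F.chart U i) le_top := by
    congr 1
    exact F.comm
  exact congr($(h1.trans (h3.trans h2.symm)) ((Scheme.ΓSpecIso (.of ℂ)).inv c))

lemma mulForm_apply (ℓ : Sym 1) (v : F.E U (-1)) (i : Fin 3) :
    (F.mulForm U ℓ v).1 i = F.frac U i ℓ * v.1 i := rfl

/-- A line in the plane which misses the fibre of `Z` over a given point. -/
lemma exists_forall_mem_basicOpen (x : T) :
    ∃ ℓ : Sym 1, ∀ z, F.toBase z = x → F.toPlane z ∈ Proj.basicOpen Sym (ℓ : MvPolynomial (Fin 3) ℂ) := by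
  have := F.isFinite
  have hfin : (F.toBase ⁻¹' {x}).Finite := F.toBase.finite_preimage_singleton x
  -- The linear forms vanishing at a point form a proper subspace, since some coordinate is nonzero
  -- there. A vector space over `ℂ` is not a finite union of proper subspaces.
  let P (y : Plane) : Submodule ℂ (Sym 1) :=
    (y.asHomogeneousIdeal.toIdeal.restrictScalars ℂ).comap (Sym 1).subtype
  have hP (y : Plane) (ℓ : Sym 1) :
      ℓ ∉ P y ↔ y ∈ Proj.basicOpen Sym (ℓ : MvPolynomial (Fin 3) ℂ) := Iff.rfl
  let s : Finset (Submodule ℂ (Sym 1)) := (hfin.image fun z => P (F.toPlane z)).toFinset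
  have hs : ⊤ ∉ s := by
    intro h
    obtain ⟨z, -, hz⟩ := (Set.Finite.mem_toFinset _).1 h
    have hmem : F.toPlane z ∈ ⨆ i, planeChart i := by rw [iSup_planeChart]; trivial
    obtain ⟨i, hi⟩ := TopologicalSpace.Opens.mem_iSup.1 hmem
    refine (hP _ _).2 hi ?_
    dsimp only at hz
    rw [hz]
    trivial
  obtain ⟨ℓ, hℓ⟩ := (Set.ne_univ_iff_exists_notMem _).1
    (Subspace.biUnion_ne_univ_of_top_notMem hs)
  refine ⟨ℓ, fun z hz => (hP _ _).1 fun h => hℓ ?_⟩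
  exact Set.mem_biUnion (show P (F.toPlane z) ∈ s from
    (Set.Finite.mem_toFinset _).2 ⟨z, hz, rfl⟩) h

/-- A finite morphism is closed, so the points of `T` whose fibre meets the line form a closed set,
which avoids `x`. -/
lemma exists_preimage_basicOpen_le {U} (hU : IsAffineOpen U) {x : T} (hx : x ∈ U) :
    ∃ (s : Γ(T, U)) (ℓ : Sym 1), x ∈ T.basicOpen s ∧
      F.toBase ⁻¹ᵁ T.basicOpen s ≤
        F.toPlane ⁻¹ᵁ Proj.basicOpen Sym (ℓ : MvPolynomial (Fin 3) ℂ) := by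
  obtain ⟨ℓ, hℓ⟩ := F.exists_forall_mem_basicOpen x
  have := F.isFinite
  let D : F.Z.Opens := F.toPlane ⁻¹ᵁ Proj.basicOpen Sym (ℓ : MvPolynomial (Fin 3) ℂ)
  have hcl : IsClosed (F.toBase '' (D : Set F.Z)ᶜ) :=
    F.toBase.isClosedMap _ D.isOpen.isClosed_compl
  let V : T.Opens := ⟨(F.toBase '' (D : Set F.Z)ᶜ)ᶜ, hcl.isOpen_compl⟩
  have hxV : x ∈ V := by
    rintro ⟨z, hz, rfl⟩
    exact hz (hℓ z rfl)
  obtain ⟨s, hs, hxs⟩ := hU.exists_basicOpen_le (V := V) ⟨x, hxV⟩ hx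
  refine ⟨s, ℓ, hxs, fun z hz => ?_⟩
  by_contra h
  exact hs hz ⟨z, h, rfl⟩

end Family

/-! ### Clearing denominators on basic opens -/

/-- The elements that become images of elements of `A` after multiplication by a power of the
image of `s`. -/
def denominatorSubring {B C : Type*} [CommRing B] [CommRing C] (ρ : B →+* C) (A : Subring B) {s : B}
    (hs : s ∈ A) : Subring C where
  carrier := {c | ∃ k : ℕ, ∃ a ∈ A, ρ s ^ k * c = ρ a}
  mul_mem' := by
    rintro c d ⟨k, a, ha, hc⟩ ⟨l, b, hb, hd⟩
    exact ⟨k + l, a * b, mul_mem ha hb, by rw [map_mul, ← hc, ← hd]; ring⟩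
  one_mem' := ⟨0, 1, one_mem A, by simp⟩
  add_mem' := by
    rintro c d ⟨k, a, ha, hc⟩ ⟨l, b, hb, hd⟩
    refine ⟨k + l, s ^ l * a + s ^ k * b,
      add_mem (mul_mem (pow_mem hs _) ha) (mul_mem (pow_mem hs _) hb), ?_⟩
    rw [map_add, map_mul, map_mul, ← hc, ← hd, map_pow, map_pow]
    ring
  zero_mem' := ⟨0, 0, zero_mem A, by simp⟩
  neg_mem' := by
    rintro c ⟨k, a, ha, hc⟩
    exact ⟨k, -a, neg_mem ha, by rw [map_neg, ← hc, mul_neg]⟩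

section BasicOpen

variable {X : Scheme.{0}} {V D : X.Opens} (hV : IsAffineOpen V) (f : Γ(X, V))
  (e : D = X.basicOpen f) (h : D ≤ V)

include hV e

lemma exists_map_eq_pow_mul (c : Γ(X, D)) : ∃ (k : ℕ) (b : Γ(X, V)),
    X.presheaf.map (homOfLE h).op b = X.presheaf.map (homOfLE h).op f ^ k * c := by
  let := (X.presheaf.map (homOfLE h).op).hom.toAlgebra
  have : IsLocalization.Away f Γ(X, D) := hV.isLocalization_of_eq_basicOpen f (homOfLE h) e
  obtain ⟨⟨b, _, k, rfl⟩, hb⟩ := IsLocalization.surj (Submonoid.powers f) c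
  refine ⟨k, b, hb.symm.trans ?_⟩
  rw [mul_comm, ← map_pow]
  rfl

lemma exists_pow_mul_eq {a b : Γ(X, V)}
    (hab : X.presheaf.map (homOfLE h).op a = X.presheaf.map (homOfLE h).op b) :
    ∃ k : ℕ, f ^ k * a = f ^ k * b := by
  let := (X.presheaf.map (homOfLE h).op).hom.toAlgebra
  have : IsLocalization.Away f Γ(X, D) := hV.isLocalization_of_eq_basicOpen f (homOfLE h) e
  obtain ⟨⟨_, k, rfl⟩, hk⟩ := (IsLocalization.eq_iff_exists (Submonoid.powers f) Γ(X, D)).1 hab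
  exact ⟨k, hk⟩

end BasicOpen

lemma preimage_basicOpen_inf {X Y : Scheme.{0}} (f : X ⟶ Y) {U : Y.Opens} {V : X.Opens}
    (h : V ≤ f ⁻¹ᵁ U) (s : Γ(Y, U)) :
    f ⁻¹ᵁ Y.basicOpen s ⊓ V = X.basicOpen (f.appLE U V h s) := by
  rw [Scheme.basicOpen_appLE, inf_comm]

/-! ### Division by a line that misses the family -/

namespace Family

variable {r : ℕ} {T : Scheme.{0}} {t : T ⟶ Spec (.of ℂ)} (F : Family r t) (U : T.Opens)

section Frac

variable {V V' : F.Z.Opens} {f g : Sym 1}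

/-- The function `ℓ / f` on an open subset of `Z` where `f ≠ 0`. -/
def fracAt (hV : V ≤ F.toPlane ⁻¹ᵁ Proj.basicOpen Sym (f : MvPolynomial (Fin 3) ℂ)) (ℓ : Sym 1) :
    Γ(F.Z, V) :=
  F.toPlane.appLE _ V hV (ratioAt f ℓ)

lemma map_fracAt (hV : V ≤ F.toPlane ⁻¹ᵁ Proj.basicOpen Sym (f : MvPolynomial (Fin 3) ℂ))
    (h : V' ≤ V) (ℓ : Sym 1) :
    F.Z.presheaf.map (homOfLE h).op (F.fracAt hV ℓ) = F.fracAt (h.trans hV) ℓ :=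
  congr($(F.toPlane.appLE_map hV (homOfLE h).op) (ratioAt f ℓ))

lemma fracAt_mul_fracAt (hf : V ≤ F.toPlane ⁻¹ᵁ Proj.basicOpen Sym (f : MvPolynomial (Fin 3) ℂ))
    (hg : V ≤ F.toPlane ⁻¹ᵁ Proj.basicOpen Sym (g : MvPolynomial (Fin 3) ℂ)) (ℓ : Sym 1) :
    F.fracAt hg ℓ * F.fracAt hf g = F.fracAt hf ℓ := by
  let D := Proj.basicOpen Sym (f : MvPolynomial (Fin 3) ℂ)
  let D' := Proj.basicOpen Sym (g : MvPolynomial (Fin 3) ℂ)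
  have hfg : V ≤ F.toPlane ⁻¹ᵁ (D ⊓ D') := le_inf hf hg
  have h1 (ℓ : Sym 1) : F.fracAt hf ℓ = F.toPlane.appLE (D ⊓ D') V hfg
      (Plane.presheaf.map (homOfLE inf_le_left).op (ratioAt f ℓ)) :=
    congr($((F.toPlane.map_appLE hfg (homOfLE (inf_le_left : D ⊓ D' ≤ D)).op).symm) (ratioAt f ℓ))
  have h2 : F.fracAt hg ℓ = F.toPlane.appLE (D ⊓ D') V hfg
      (Plane.presheaf.map (homOfLE inf_le_right).op (ratioAt g ℓ)) :=
    congr($((F.toPlane.map_appLE hfg (homOfLE (inf_le_right : D ⊓ D' ≤ D')).op).symm) (ratioAt g ℓ))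
  rw [h1, h1, h2]
  refine (map_mul (F.toPlane.appLE (D ⊓ D') V hfg).hom _ _).symm.trans ?_
  congr 1
  exact ratioAt_mul_ratioAt _ _ ℓ

lemma fracAt_self (hf : V ≤ F.toPlane ⁻¹ᵁ Proj.basicOpen Sym (f : MvPolynomial (Fin 3) ℂ)) :
    F.fracAt hf f = 1 := by
  rw [fracAt, ratioAt_self]
  exact map_one (F.toPlane.appLE _ V hf).hom

end Frac

attribute [local instance] commRingE algebraE moduleE isScalarTowerE

variable {U} {s : F.Base U} {ℓ₀ : Sym 1}
  (hs : F.toBase ⁻¹ᵁ T.basicOpen (U := U) s ≤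
    F.toPlane ⁻¹ᵁ Proj.basicOpen Sym (ℓ₀ : MvPolynomial (Fin 3) ℂ))

include hs in
-- Where `s ≠ 0`, the function `ℓ₀ / xᵢ` has the inverse `xᵢ / ℓ₀`; `u` extends this inverse to the
-- chart after multiplication by a power of `s`.
lemma exists_frac_mul_eq_pow (hU : IsAffineOpen U) (i : Fin 3) :
    ∃ (k : ℕ) (u : F.ChartRing U i), F.frac U i ℓ₀ * u = algebraMap (F.Base U) _ s ^ k := by
  let V := F.toBase ⁻¹ᵁ T.basicOpen (U := U) s ⊓ F.chart U i
  let s' : Γ(F.Z, F.chart U i) := F.toBase.appLE U (F.chart U i) inf_le_left s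
  have hVi : V ≤ F.chart U i := inf_le_right
  have hC : IsAffineOpen (F.chart U i) := (F.isAffineOpen_and_surjective (coord i) hU).1
  have e : V = F.Z.basicOpen s' := preimage_basicOpen_inf F.toBase _ s
  have hVℓ : V ≤ F.toPlane ⁻¹ᵁ Proj.basicOpen Sym (ℓ₀ : MvPolynomial (Fin 3) ℂ) :=
    inf_le_left.trans hs
  obtain ⟨k, b, hb⟩ := exists_map_eq_pow_mul hC s' e hVi (F.fracAt hVℓ (coord i))
  let ρ : Γ(F.Z, F.chart U i) →+* Γ(F.Z, V) := (F.Z.presheaf.map (homOfLE hVi).op).hom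
  let y : Γ(F.Z, F.chart U i) := F.frac U i ℓ₀
  have hy : ρ y = F.fracAt (hVi.trans inf_le_right) ℓ₀ := F.map_fracAt _ hVi ℓ₀
  have h1 : ρ (y * b) = ρ (s' ^ k) := by
    rw [map_mul, hy, show ρ b = ρ s' ^ k * _ from hb, map_pow, mul_left_comm, mul_comm (F.fracAt _ _),
      fracAt_mul_fracAt, fracAt_self, mul_one]
  obtain ⟨l, hl⟩ := exists_pow_mul_eq hC s' e hVi h1
  refine ⟨l + k, s' ^ l * b, ?_⟩
  change y * (s' ^ l * b) = s' ^ (l + k)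
  rw [mul_left_comm, hl, pow_add]

include hs in
/-- Over an affine open where the line `ℓ₀` misses `Z`, a power of `s` is a multiple of `ℓ₀`. -/
lemma exists_coe_eq_pow_mul (hU : IsAffineOpen U) :
    ∃ (k : ℕ) (v : F.E U (-1)) (u : ∀ i, F.ChartRing U i),
      (∀ i, F.frac U i ℓ₀ * u i = algebraMap (F.Base U) _ s ^ k) ∧
      ∀ i, v.1 i = algebraMap (F.Base U) _ s ^ k * u i := by
  choose k u hu using F.exists_frac_mul_eq_pow hs hU
  let m := ∑ i, k i
  have hm (i : Fin 3) : k i ≤ m := Finset.single_le_sum (fun _ _ => Nat.zero_le _) (Finset.mem_univ i)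
  let w (i : Fin 3) : F.ChartRing U i := algebraMap (F.Base U) _ s ^ (m - k i) * u i
  have hw (i : Fin 3) : F.frac U i ℓ₀ * w i = algebraMap (F.Base U) _ s ^ m := by
    rw [mul_left_comm, hu, ← pow_add, Nat.sub_add_cancel (hm i)]
  clear_value w m
  -- The `w i` need not glue, but `s ^ m w_i` do: on overlaps `s ^ m w_j = (ℓ₀ / xᵢ) w_i w_j = (xⱼ /
  -- xᵢ) (ℓ₀ / xⱼ) w_j w_i = (xⱼ / xᵢ) s ^ m w_i`.
  refine ⟨m, ⟨fun i => algebraMap (F.Base U) _ s ^ m * w i, ?_⟩, w, hw, fun i => rfl⟩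
  rw [mem_E_neg_one]
  intro i j
  have h1 := congrArg (F.resLeft U i j) (hw i)
  have h2 := congrArg (F.resRight U i j) (hw j)
  have h3 := F.frac_mul_frac U i j ℓ₀
  rw [map_mul, map_pow, resLeft_algebraMap] at h1
  rw [map_mul, map_pow, resRight_algebraMap] at h2
  rw [map_mul, map_mul, map_pow, map_pow, resLeft_algebraMap, resRight_algebraMap]
  linear_combination F.resLeft U i j (F.frac U i (coord j)) * F.resLeft U i j (w i) * h2 -
    F.resRight U i j (w j) * h1 -
    F.resLeft U i j (w i) * F.resRight U i j (w j) * h3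

lemma toChart_totalEquiv_symm (b : F.E U 0) (i : Fin 3) :
    F.toChart U i ((F.totalEquiv U).symm b) = b.1 i :=
  congr($((F.totalEquiv U).apply_symm_apply b).1 i)

/-- The restriction of a section of `ℰ_0` to an open subset of `Z` above `U`. -/
def restrict {V : F.Z.Opens} (hV : V ≤ F.toBase ⁻¹ᵁ U) : F.E U 0 →+* Γ(F.Z, V) :=
  (F.Z.presheaf.map (homOfLE hV).op).hom.comp (F.totalEquiv U).symm.toAlgHom.toRingHom

lemma restrict_algebraMap {V : F.Z.Opens} (hV : V ≤ F.toBase ⁻¹ᵁ U) (a : F.Base U) :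
    F.restrict hV (algebraMap _ _ a) = F.toBase.appLE U V hV a := by
  change F.Z.presheaf.map (homOfLE hV).op ((F.totalEquiv U).symm (algebraMap _ _ a)) = _
  rw [AlgEquiv.commutes]
  rfl

lemma map_restrict {V V' : F.Z.Opens} (hV : V ≤ F.toBase ⁻¹ᵁ U) (h : V' ≤ V) {i : Fin 3}
    (hi : V' ≤ F.chart U i) (b : F.E U 0) :
    F.Z.presheaf.map (homOfLE h).op (F.restrict hV b) = F.Z.presheaf.map (homOfLE hi).op (b.1 i) := by
  rw [← toChart_totalEquiv_symm]
  exact congr($((F.Z.presheaf.map_comp (homOfLE hV).op (homOfLE h).op).symm.trans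
    (F.Z.presheaf.map_comp (homOfLE (inf_le_left : F.chart U i ≤ F.toBase ⁻¹ᵁ U)).op
      (homOfLE hi).op)) ((F.totalEquiv U).symm b))

/-- If `v = s ^ (2 * k) / ℓ₀`, then `ℓ * v = s ^ (2 * k) * (ℓ / ℓ₀)`. -/
lemma restrict_mulForm {V : F.Z.Opens} (hV : V ≤ F.toBase ⁻¹ᵁ U)
    (hVℓ : V ≤ F.toPlane ⁻¹ᵁ Proj.basicOpen Sym (ℓ₀ : MvPolynomial (Fin 3) ℂ)) {k : ℕ}
    {v : F.E U (-1)} {u : ∀ i, F.ChartRing U i}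
    (hu : ∀ i, F.frac U i ℓ₀ * u i = algebraMap (F.Base U) _ s ^ k)
    (hv : ∀ i, v.1 i = algebraMap (F.Base U) _ s ^ k * u i) (ℓ : Sym 1) :
    F.restrict hV (F.mulForm U ℓ v) =
      F.restrict hV (algebraMap _ _ s) ^ (2 * k) * F.fracAt hVℓ ℓ := by
  have hcov : V ≤ ⨆ i, V ⊓ F.chart U i := by
    rw [← inf_iSup_eq, ← F.iSup_chart]
    exact le_inf le_rfl hV
  refine F.Z.sheaf.eq_of_locally_eq' (fun i => V ⊓ F.chart U i) V (fun i => homOfLE inf_le_left)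
    hcov _ _ fun i => ?_
  change F.Z.presheaf.map (homOfLE inf_le_left).op _ = F.Z.presheaf.map (homOfLE inf_le_left).op _
  have h1 : V ⊓ F.chart U i ≤ V := inf_le_left
  have h2 : V ⊓ F.chart U i ≤ F.chart U i := inf_le_right
  rw [F.map_restrict hV h1 h2]
  let ρ : F.ChartRing U i →+* Γ(F.Z, V ⊓ F.chart U i) := (F.Z.presheaf.map (homOfLE h2).op).hom
  let τ : Γ(F.Z, V) →+* Γ(F.Z, V ⊓ F.chart U i) := (F.Z.presheaf.map (homOfLE h1).op).hom
  change ρ ((F.mulForm U ℓ v).1 i) = τ (F.restrict hV (algebraMap _ _ s) ^ (2 * k) * F.fracAt hVℓ ℓ)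
  have hs' : τ (F.restrict hV (algebraMap _ _ s)) = ρ (algebraMap _ _ s) := by
    rw [← F.coe_algebraMap]
    exact F.map_restrict hV h1 h2 _
  have hy (ℓ : Sym 1) : ρ (F.frac U i ℓ) = F.fracAt (h2.trans inf_le_right) ℓ :=
    F.map_fracAt _ h2 ℓ
  have hz : τ (F.fracAt hVℓ ℓ) = F.fracAt (h1.trans hVℓ) ℓ := F.map_fracAt _ h1 ℓ
  have h3 := F.fracAt_mul_fracAt (h2.trans inf_le_right : _ ≤
    F.toPlane ⁻¹ᵁ Proj.basicOpen Sym (coord i : MvPolynomial (Fin 3) ℂ)) (h1.trans hVℓ) ℓ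
  have h4 := congrArg ρ (hu i)
  rw [map_mul, hy, map_pow] at h4
  rw [mulForm_apply, hv, map_mul, map_mul, map_mul, map_pow, map_pow, hs', hy, hz]
  linear_combination (-ρ (algebraMap _ _ s) ^ k * ρ (u i)) * h3 +
    (ρ (algebraMap _ _ s) ^ k * F.fracAt (h1.trans hVℓ) ℓ) * h4

include hs in
-- Where `s ≠ 0`, functions on `Z` are generated by functions on the base, of the form `c / s ^ l`,
-- and by the ratios `ℓ / ℓ₀`, which are `ℓ v / s ^ (2 * k)`. All of these lie in the subring of
-- elements that a power of `s` carries into the adjoined algebra.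
lemma exists_pow_smul_mem_adjoin (hU : IsAffineOpen U) :
    ∃ (k : ℕ) (v : F.E U (-1)), F.mulForm U ℓ₀ v = algebraMap _ _ (s ^ k) ∧
      ∀ b : F.E U 0, ∃ l : ℕ, s ^ l • b ∈
        Algebra.adjoin (F.Base U) (Set.range fun ℓ => F.mulForm U ℓ v) := by
  obtain ⟨k, v, u, hu, hv⟩ := F.exists_coe_eq_pow_mul hs hU
  refine ⟨2 * k, v, Subtype.ext (funext fun i => ?_), fun b => ?_⟩
  · rw [mulForm_apply, hv, coe_algebraMap, mul_left_comm, hu, ← pow_add, map_pow, two_mul]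
  let W : T.Opens := T.basicOpen (U := U) s
  have hWU : W ≤ U := T.basicOpen_le _
  have hW : IsAffineOpen W := hU.basicOpen _
  let V := F.chartAt W ℓ₀
  have hVU : V ≤ F.toBase ⁻¹ᵁ U := inf_le_left.trans ((TopologicalSpace.Opens.map _).monotone hWU)
  have hVℓ : V ≤ F.toPlane ⁻¹ᵁ Proj.basicOpen Sym (ℓ₀ : MvPolynomial (Fin 3) ℂ) := inf_le_right
  let A := Algebra.adjoin (F.Base U) (Set.range fun ℓ => F.mulForm U ℓ v)
  let ρ := F.restrict hVU
  have hsA : algebraMap (F.Base U) (F.E U 0) s ∈ A.toSubring := A.algebraMap_mem s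
  obtain ⟨-, htop⟩ := F.isAffineOpen_and_surjective ℓ₀ hW
  have hS := htop (denominatorSubring ρ A.toSubring hsA) (fun a => ?_) fun a => ?_
  · obtain ⟨l, a, ha, hl⟩ : ρ b ∈ denominatorSubring ρ A.toSubring hsA := hS ▸ trivial
    -- By `hs` the condition `ℓ₀ ≠ 0` is automatic above `W`, so `V` is a basic open of the affine
    -- scheme above `U`.
    have e : V = F.Z.basicOpen (F.toBase.app U s) :=
      (inf_eq_left.2 hs).trans (Scheme.preimage_basicOpen F.toBase s)
    let θ := (F.totalEquiv U).symm
    obtain ⟨m, hm⟩ := exists_pow_mul_eq (F.isAffineOpen_total hU) (F.toBase.app U s) e hVU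
      (a := θ (algebraMap _ _ s ^ l * b)) (b := θ a) <| by
        refine Eq.trans ?_ hl
        change ρ (algebraMap _ _ s ^ l * b) = _
        rw [map_mul, map_pow]
    refine ⟨m + l, ?_⟩
    have h1 : algebraMap _ (F.E U 0) s ^ m * (algebraMap _ _ s ^ l * b) =
        algebraMap _ _ s ^ m * a := by
      apply θ.injective
      rw [map_mul, map_mul θ _ a, map_pow, AlgEquiv.commutes]
      exact hm
    rw [Algebra.smul_def, pow_add, map_mul, map_pow, map_pow, mul_assoc, h1]
    exact mul_mem (pow_mem hsA m) ha
  · obtain ⟨l, c, hc⟩ := exists_map_eq_pow_mul hU s (show W = _ from rfl) hWU a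
    refine ⟨l, algebraMap (F.Base U) _ c, A.algebraMap_mem c, ?_⟩
    have h1 (x : Γ(T, U)) : F.toBase.appLE W V inf_le_left (T.presheaf.map (homOfLE hWU).op x) =
        ρ (algebraMap (F.Base U) _ x) :=
      congr($(F.toBase.map_appLE inf_le_left (homOfLE hWU).op) x).trans
        (F.restrict_algebraMap hVU x).symm
    have h2 := congrArg (F.toBase.appLE W V inf_le_left).hom hc
    rw [map_mul, map_pow] at h2
    exact (congrArg (fun x => x ^ l * F.toBase.appLE W V inf_le_left a) (h1 s)).symm.trans
      (h2.symm.trans (h1 c))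
  · refine mem_of_ratioAt_mem ((denominatorSubring ρ A.toSubring hsA).comap
      (F.toPlane.appLE _ V hVℓ).hom) (fun ℓ => ?_) a
    exact ⟨2 * k, F.mulForm U ℓ v, Algebra.subset_adjoin ⟨ℓ, rfl⟩,
      (F.restrict_mulForm hVU hVℓ hu hv ℓ).symm⟩

lemma exists_local (hU : IsAffineOpen U) (m : Ideal (F.Base U)) (hm : m.IsMaximal) :
    ∃ s ∉ m, ∃ (ℓ : Sym 1) (u : F.E U (-1)), F.mulForm U ℓ u = algebraMap (F.Base U) _ s ∧
      ∀ b : F.E U 0, ∃ r ∉ m, r • b ∈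
        Algebra.adjoin (F.Base U) (Set.range fun ℓ' => F.mulForm U ℓ' u) := by
  let y : PrimeSpectrum Γ(T, U) := ⟨m, hm.isPrime⟩
  let x : T := hU.fromSpec y
  have hx : x ∈ U := hU.opensRange_fromSpec.le ⟨y, rfl⟩
  obtain ⟨s, ℓ₀, hxs, hs⟩ := F.exists_preimage_basicOpen_le hU hx
  have hsm (k : ℕ) : s ^ k ∉ m := by
    have h1 : y ∈ hU.fromSpec ⁻¹ᵁ T.basicOpen s := hxs
    rw [hU.fromSpec_preimage_basicOpen] at h1
    exact fun h => h1 (hm.isPrime.mem_of_pow_mem k h)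
  obtain ⟨k, v, hv, hA⟩ := F.exists_pow_smul_mem_adjoin hs hU
  exact ⟨_, hsm k, ℓ₀, v, hv, fun b => (hA b).imp' _ fun l hl => ⟨hsm l, hl⟩⟩

/-- The linear forms as maps `ℰ_{-1} → ℰ_0`. -/
def linearForms (hU : IsAffineOpen U) :
    LinearForms (F.Base U) (F.E U 0) (F.E U (-1)) where
  mul := F.mulForm U
  mul_add_left ℓ ℓ' := LinearMap.ext fun v => Subtype.ext <| funext fun i => by
    rw [LinearMap.add_apply, mulForm_apply, frac_add, add_mul]
    rfl
  mul_smul_left c ℓ := LinearMap.ext fun v => Subtype.ext <| funext fun i => by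
    rw [LinearMap.smul_apply, mulForm_apply, frac_smul, mul_assoc, ← Algebra.smul_def]
    rfl
  mul_smul ℓ b v := Subtype.ext <| funext fun i => mul_left_comm _ _ _
  mul_comm ℓ v w := Subtype.ext <| funext fun i => mul_right_comm _ _ _
  exists_local := F.exists_local hU

end Family

/-! ### Rank one quotients and the conclusion -/

/-- A rank `k` quotient of the target of a surjective map is a rank `k` quotient of the source. -/
lemma exists_grassmannian_eq_comap {R M N : Type*} [CommRing R] [AddCommGroup M] [Module R M]
    [AddCommGroup N] [Module R N] {k : ℕ} (p : M →ₗ[R] N) (hp : Function.Surjective p)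
    (K : Module.Grassmannian R N k) :
    ∃ Q : Module.Grassmannian R M k, Q.toSubmodule = K.toSubmodule.comap p :=
  let e : (M ⧸ K.toSubmodule.comap p) ≃ₗ[R] N ⧸ K.toSubmodule :=
    LinearEquiv.ofBijective (Submodule.mapQ _ _ p le_rfl)
      ⟨LinearMap.ker_eq_bot.1 (by rw [Submodule.ker_mapQ, Submodule.mkQ_map_self]), by
        rw [← LinearMap.range_eq_top, Submodule.range_mapQ, LinearMap.range_eq_top.2 hp,
          Submodule.map_top, Submodule.range_mkQ]⟩
  ⟨{ toSubmodule := K.toSubmodule.comap p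
     finite_quotient := Module.Finite.equiv e.symm
     projective_quotient := Module.Projective.of_equiv e.symm
     rankAtStalk_eq := fun q => by rw [Module.rankAtStalk_eq_of_equiv e, K.rankAtStalk_eq] }, rfl⟩

namespace Family

variable {n : ℕ} {T : Scheme.{0}} {t : T ⟶ Spec (.of ℂ)} (F : Family (n + 1) t) {U : T.Opens}

lemma existsUnique_isMinorMap_and_surjective (hU : IsAffineOpen U) :
    (∃! p : F.SV U →ₗ[F.Base U] F.EL U, F.IsMinorMap U p) ∧
      ∀ p : F.SV U →ₗ[F.Base U] F.EL U, F.IsMinorMap U p → Function.Surjective p := by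
  have := F.finite_E hU
  have := F.projective_E hU
  let _ := F.commRingE U
  let _ := F.algebraE U
  let _ := F.moduleE U
  have := F.isScalarTowerE U
  have h := (F.linearForms hU).existsUnique_and_surjective (n := n) (F.rankAtStalk_E hU)
  simp only [F.isMinorMap_iff U]
  exact h

end Family

end DarbouxBundle

end

theorem mainTheorem12 (n : ℕ) :
    -- the bundle map over the Hilbert scheme `H = Hilb^(n+1)` exists, is unique and is surjective
    (∀ (H : Scheme.{0}) (h : H ⟶ Spec (.of ℂ)) (F : DarbouxBundle.Family (n + 1) h),
      F.IsUniversal → ∀ U : H.Opens, IsAffineOpen U →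
        (∃! p : F.SV U →ₗ[F.Base U] F.EL U, F.IsMinorMap U p) ∧
        ∀ p : F.SV U →ₗ[F.Base U] F.EL U, F.IsMinorMap U p → Function.Surjective p) ∧
    -- the same over the base `T` of any family, that is, for any morphism `T ⟶ H`; and every
    -- rank one quotient of `ℰ_{-1} ⊗ ℒ` (every point of `ℙ(ℰ_{-1} ⊗ ℒ)`) induces via `p` a rank one
    -- quotient of `S_n V` (a point of `ℙ(S_n V)`)
    (∀ (T : Scheme.{0}) (t : T ⟶ Spec (.of ℂ)) (F : DarbouxBundle.Family (n + 1) t)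
      (U : T.Opens), IsAffineOpen U →
        (∃! p : F.SV U →ₗ[F.Base U] F.EL U, F.IsMinorMap U p) ∧
        ∀ p : F.SV U →ₗ[F.Base U] F.EL U, F.IsMinorMap U p →
          Function.Surjective p ∧
          ∀ K : Module.Grassmannian (F.Base U) (F.EL U) 1,
            ∃ Q : Module.Grassmannian (F.Base U) (F.SV U) 1,
              Q.toSubmodule = K.toSubmodule.comap p) ∧
    -- for a punctual scheme `Z = Spec ℂ[x, y] / I` supported at the origin, the inverses of the
    -- linear forms `1 - a x - b y` span `𝒪_Z`
    (∀ I : Ideal (MvPolynomial (Fin 2) ℂ),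
      I.radical = Ideal.span {MvPolynomial.X 0, MvPolynomial.X 1} →
        (∀ a b : ℂ, IsUnit (Ideal.Quotient.mk I (1 - MvPolynomial.C a * MvPolynomial.X 0 -
          MvPolynomial.C b * MvPolynomial.X 1))) ∧
        Submodule.span ℂ {u : MvPolynomial (Fin 2) ℂ ⧸ I | ∃ a b : ℂ,
          u * Ideal.Quotient.mk I (1 - MvPolynomial.C a * MvPolynomial.X 0 -
            MvPolynomial.C b * MvPolynomial.X 1) = 1} = ⊤) := by
  refine ⟨fun H h F _ U hU => F.existsUnique_isMinorMap_and_surjective hU, fun T t F U hU => ?_,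
    fun I hI => ⟨DarbouxBundle.isUnit_one_sub_linear hI, DarbouxBundle.span_inverses_eq_top hI⟩⟩
  have h := F.existsUnique_isMinorMap_and_surjective hU
  exact ⟨h.1, fun p hp => ⟨h.2 p hp, fun K =>
    DarbouxBundle.exists_grassmannian_eq_comap p (h.2 p hp) K⟩⟩
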